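/- For every integer $N\ge 1$ let $M_N$ be an $N\times N$ complex Ginibre matrix, i.e. a random complex matrix such that the $2N^2$ real random variables $\Re (M_N)_{i,j},\ \Im (M_N)_{i,j}$ ($1\le i,j\le N$) are independent with law $\mathcal N(0,1/2)$ (mean $0$, variance $1/2$). All the matrices $M_N$, $N\ge1$, are defined on one probability space; nothing is assumed about their joint law for different $N$. Let $\lambda_1^N,\dots,\lambda_N^N\in\mathbb C$ be the eigenvalues of $M_N$, counted with algebraic multiplicity, and let $$\mu_N=\frac1N\sum_{k=1}^N\delta_{\lambda_k^N/\sqrt N},\qquad \mu_\infty(dz)=\frac{\mathbf 1_{|z|\le 1}}{\pi}\,dz,$$ where $dz$ is Lebesgue measure on $\mathbb C\cong\mathbb R^2$. Then almost surely the probability measures $\mu_N$ converge weakly (in law) to $\mu_\infty$ as $N\to+\infty$; that is, almost surely, for every bounded continuous $f:\mathbb C\to\mathbb R$, $\int_{\mathbb C} f\,d\mu_N\to\int_{\mathbb C} f\,d\mu_\infty$. -/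

import Mathlib

open MeasureTheory ProbabilityTheory Filter Topology
open scoped ENNReal NNReal

noncomputable section

/-- A random matrix `M`, defined on a probability space `(Ω, P)`, is an `N` complex Ginibre matrix:
the real parts and the imaginary parts of its `N²` entries form a family of `2N²` independent real
Gaussian random variables of law `𝒩(0, 1/2)` (mean `0`, variance `1/2`). -/
structure IsGinibre {Ω : Type*} [MeasurableSpace Ω] (P : Measure Ω) {N : ℕ}
    (M : Ω → Matrix (Fin N) (Fin N) ℂ) : Prop where
  hasLaw_re : ∀ i j, HasLaw (fun ω => (M ω i j).re) (gaussianReal 0 (1 / 2)) P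
  hasLaw_im : ∀ i j, HasLaw (fun ω => (M ω i j).im) (gaussianReal 0 (1 / 2)) P
  indep : iIndepFun
    (fun (k : (Fin N × Fin N) ⊕ (Fin N × Fin N)) (ω : Ω) =>
      Sum.elim (fun ij => (M ω ij.1 ij.2).re) (fun ij => (M ω ij.1 ij.2).im) k) P

/-- The eigenvalues of a complex square matrix, listed with their algebraic multiplicities. -/
def spectrumMultiset {N : ℕ} (A : Matrix (Fin N) (Fin N) ℂ) : Multiset ℂ :=
  A.charpoly.roots

/-- `(1/N) ∑ₖ δ_{λₖ/√N}`, where `λ₁, …, λ_N` are the eigenvalues of the `N × N` matrix `A`. -/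
def empiricalSpectralMeasure {N : ℕ} (A : Matrix (Fin N) (Fin N) ℂ) : Measure ℂ :=
  (N : ℝ≥0∞)⁻¹ •
    ((spectrumMultiset A).map fun z => Measure.dirac (z / ((Real.sqrt N : ℝ) : ℂ))).sum

theorem card_spectrumMultiset {N : ℕ} (A : Matrix (Fin N) (Fin N) ℂ) :
    (spectrumMultiset A).card = N := by
  have h := (IsAlgClosed.splits A.charpoly).natDegree_eq_card_roots
  rw [Matrix.charpoly_natDegree_eq_dim, Fintype.card_fin] at h
  exact h.symm

theorem sum_map_dirac_univ (s : Multiset ℂ) (g : ℂ → ℂ) :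
    (s.map fun z => Measure.dirac (g z)).sum Set.univ = (s.card : ℝ≥0∞) := by
  induction s using Multiset.induction_on with
  | empty => simp
  | cons a s ih =>
    rw [Multiset.map_cons, Multiset.sum_cons, Measure.add_apply, ih]
    simp [add_comm]

instance isProbabilityMeasure_empiricalSpectralMeasure {N : ℕ} [NeZero N]
    (A : Matrix (Fin N) (Fin N) ℂ) : IsProbabilityMeasure (empiricalSpectralMeasure A) := by
  constructor
  rw [empiricalSpectralMeasure, Measure.smul_apply, sum_map_dirac_univ, card_spectrumMultiset,
    smul_eq_mul]
  exact ENNReal.inv_mul_cancel (by simpa using NeZero.ne N) (ENNReal.natCast_ne_top N)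

/-- The uniform distribution on the closed unit disk: the measure on `ℂ` with density
`𝟙_{|z| ≤ 1} / π` with respect to Lebesgue measure. -/
def uniformDisk : Measure ℂ :=
  volume.withDensity
    ((Metric.closedBall (0 : ℂ) 1).indicator fun _ => ENNReal.ofReal (1 / Real.pi))

instance isProbabilityMeasure_uniformDisk : IsProbabilityMeasure uniformDisk := by
  constructor
  rw [uniformDisk, withDensity_apply _ MeasurableSet.univ, Measure.restrict_univ,
    lintegral_indicator Metric.isClosed_closedBall.measurableSet, setLIntegral_const,
    Complex.volume_closedBall]
  have h : (NNReal.pi : ℝ≥0∞) = ENNReal.ofReal Real.pi := by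
    rw [← NNReal.coe_real_pi, ENNReal.ofReal_coe_nnreal]
  rw [h, ENNReal.ofReal_one, one_pow, one_mul, ← ENNReal.ofReal_mul (by positivity),
    one_div, inv_mul_cancel₀ Real.pi_ne_zero, ENNReal.ofReal_one]

/-- The empirical spectral measure of an `N × N` matrix, `N ≥ 1`, as a probability measure. -/
def empiricalSpectralLaw {N : ℕ} [NeZero N] (A : Matrix (Fin N) (Fin N) ℂ) :
    ProbabilityMeasure ℂ :=
  ⟨empiricalSpectralMeasure A, inferInstance⟩

/-- The uniform distribution on the unit disk, as a probability measure. -/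
def uniformDiskLaw : ProbabilityMeasure ℂ :=
  ⟨uniformDisk, inferInstance⟩

end

/-! The proof goes through logarithmic potentials. For the spectral measure of an `N × N` matrix,
the potential at `z` is `log |det (M - √N z)| / N - log N / 2`, and for the uniform law on the disk
it is `diskPotential`, written `U` below. It suffices that the first tends to the second almost
surely for almost every `z`, and that convergence of potentials almost everywhere forces weak
convergence.

For fixed `z` the determinant is confined by two moments and no singular value analysis is needed.
From above, `E |det (M - √N z)|²` equals `N! ∑_{k ≤ N} (N |z|²)^k / k!`, at most `N! exp (N (2 U z +
1))` (`lintegral_norm_det_sq_le`). From below, `1 / det ((M - ζ)ᴴ (M - ζ) + t)` is a Gaussian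
integral over `φ ∈ ℂ^N`. Exchanging it with the expectation leaves an explicit radial integral, and
the same exponential rate appears (`lintegral_inv_norm_det_shiftedGram_le`). The regularization `t`
is removed by anti-concentration: the entries of `(M - ζ)⁻¹` are polynomially bounded with high
probability (`ginibreMeasure_det_lt_adjugate_le`), so a polynomially small `t` changes the
determinant by at most a factor `e` (`norm_det_conjTranspose_mul_self_add_le`). Markov's inequality
makes the exceptional probabilities `O(N⁻²)`. Borel-Cantelli then applies whatever the joint law of
the matrices, and Fubini exchanges "for every `z`, almost surely" with "almost surely, for almost
every `z`".

The deterministic half tests potentials against `f - diskAverage f r`, for `f` continuous with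
compact support. By Fubini this is integration of `f * diskKernel r` against the measure. The kernel
has constant sign and support in the disk of radius `r`, so after normalization it is an approximate
identity, playing the part of the Laplacian without any derivative. Passing to the limit in the
integrals of potentials uses a uniform logarithmic moment above and a uniform estimate of the
logarithmic singularity below (`tendsto_integral_mul_logPotential`). As the limit has mass one,
vague convergence is weak convergence. -/

/-! ### The complex Gaussian law: density bound, exponential integrals, moments. -/

/-- The standard complex Gaussian measure: real and imaginary parts are independent of law
`𝒩(0, 1/2)`. -/
noncomputable def complexGaussian : Measure ℂ :=
  ((gaussianReal 0 (1 / 2)).prod (gaussianReal 0 (1 / 2))).map Complex.measurableEquivRealProd.symm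

theorem measurePreserving_complexGaussian :
    MeasurePreserving Complex.measurableEquivRealProd.symm
      ((gaussianReal 0 (1 / 2)).prod (gaussianReal 0 (1 / 2))) complexGaussian :=
  ⟨Complex.measurableEquivRealProd.symm.measurable, rfl⟩

instance isProbabilityMeasure_complexGaussian : IsProbabilityMeasure complexGaussian :=
  Measure.isProbabilityMeasure_map Complex.measurableEquivRealProd.symm.measurable.aemeasurable

theorem gaussianPDFReal_zero_half (x : ℝ) :
    gaussianPDFReal 0 (1 / 2) x = (√Real.pi)⁻¹ * Real.exp (-x ^ 2) := by
  have : (√2 : ℝ) ≠ 0 := by positivity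
  simp [gaussianPDFReal]
  field_simp

theorem gaussianReal_zero_half_le :
    gaussianReal 0 (1 / 2) ≤ ENNReal.ofReal (√Real.pi)⁻¹ • (volume : Measure ℝ) := by
  rw [gaussianReal_of_var_ne_zero 0 (by norm_num), ← withDensity_const]
  refine withDensity_mono (Eventually.of_forall fun x => ?_)
  rw [gaussianPDF, gaussianPDFReal_zero_half]
  refine ENNReal.ofReal_le_ofReal ?_
  have : Real.exp (-x ^ 2) ≤ 1 := Real.exp_le_one_iff.2 (by nlinarith [sq_nonneg x])
  exact mul_le_of_le_one_right (by positivity) this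

theorem complexGaussian_le :
    complexGaussian ≤ ENNReal.ofReal Real.pi⁻¹ • (volume : Measure ℂ) := by
  have h1 : (gaussianReal 0 (1 / 2)).prod (gaussianReal 0 (1 / 2)) ≤
      ENNReal.ofReal Real.pi⁻¹ • (volume : Measure (ℝ × ℝ)) := by
    refine (Measure.prod_mono gaussianReal_zero_half_le gaussianReal_zero_half_le).trans ?_
    rw [Measure.prod_smul_left, Measure.prod_smul_right, smul_smul, ← ENNReal.ofReal_mul
      (by positivity), ← mul_inv, Real.mul_self_sqrt Real.pi_pos.le]
    rfl
  calc complexGaussian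
      ≤ (ENNReal.ofReal Real.pi⁻¹ • (volume : Measure (ℝ × ℝ))).map
          Complex.measurableEquivRealProd.symm :=
        Measure.map_mono h1 Complex.measurableEquivRealProd.symm.measurable
    _ = _ := by
        rw [Measure.map_smul]
        congr 1
        exact (Complex.volume_preserving_equiv_real_prod.symm _).map_eq

theorem complexGaussian_closedBall_le (c : ℂ) (r : ℝ) :
    complexGaussian (Metric.closedBall c r) ≤ ENNReal.ofReal r ^ 2 := by
  refine (complexGaussian_le _).trans ?_
  rw [Measure.smul_apply, Complex.volume_closedBall, smul_eq_mul, mul_left_comm]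
  have : (NNReal.pi : ℝ≥0∞) = ENNReal.ofReal Real.pi := by
    rw [← NNReal.coe_real_pi, ENNReal.ofReal_coe_nnreal]
  rw [this, ← ENNReal.ofReal_mul (by positivity), inv_mul_cancel₀ Real.pi_ne_zero]
  simp

theorem lintegral_exp_neg_mul_sq_sub_gaussianReal {k : ℝ} (hk : 0 ≤ k) (b : ℝ) :
    ∫⁻ x, ENNReal.ofReal (Real.exp (-k * (x - b) ^ 2)) ∂(gaussianReal 0 (1 / 2)) =
      ENNReal.ofReal ((√(1 + k))⁻¹ * Real.exp (-(k * b ^ 2 / (1 + k)))) := by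
  have hk1 : (0 : ℝ) < 1 + k := by linarith
  -- Completing the square: `x² + k (x - b)² = (1 + k) (x - k b / (1 + k))² + k b² / (1 + k)`.
  have hsplit : ∀ x : ℝ, gaussianPDFReal 0 (1 / 2) x * Real.exp (-k * (x - b) ^ 2) =
      ((√Real.pi)⁻¹ * Real.exp (-(k * b ^ 2 / (1 + k)))) *
        Real.exp (-(1 + k) * (x - k * b / (1 + k)) ^ 2) := by
    intro x
    rw [gaussianPDFReal_zero_half, mul_assoc, mul_assoc, ← Real.exp_add, ← Real.exp_add]
    congr 2
    field_simp
    ring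
  rw [← ofReal_integral_eq_lintegral_ofReal, integral_gaussianReal_eq_integral_smul (by norm_num)]
  · simp_rw [smul_eq_mul, hsplit]
    rw [integral_const_mul, integral_sub_right_eq_self
      (fun x => Real.exp (-(1 + k) * x ^ 2)), integral_gaussian, Real.sqrt_div Real.pi_pos.le]
    congr 1
    have : √Real.pi ≠ 0 := by positivity
    field_simp
  · refine Integrable.of_bound (C := 1) (by fun_prop) (Eventually.of_forall fun x => ?_)
    rw [Real.norm_eq_abs, abs_of_pos (Real.exp_pos _), Real.exp_le_one_iff]
    nlinarith [sq_nonneg (x - b), mul_nonneg hk (sq_nonneg (x - b))]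
  · exact Eventually.of_forall fun x => (Real.exp_pos _).le

theorem lintegral_exp_neg_mul_norm_sub_sq_complexGaussian {k : ℝ} (hk : 0 ≤ k) (b : ℂ) :
    ∫⁻ z, ENNReal.ofReal (Real.exp (-k * ‖z - b‖ ^ 2)) ∂complexGaussian =
      ENNReal.ofReal ((1 + k)⁻¹ * Real.exp (-(k * ‖b‖ ^ 2 / (1 + k)))) := by
  have hk1 : (0 : ℝ) < 1 + k := by linarith
  rw [← measurePreserving_complexGaussian.lintegral_comp (by fun_prop)]
  have : ∀ p : ℝ × ℝ, ENNReal.ofReal (Real.exp (-k *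
      ‖Complex.measurableEquivRealProd.symm p - b‖ ^ 2)) =
      ENNReal.ofReal (Real.exp (-k * (p.1 - b.re) ^ 2)) *
        ENNReal.ofReal (Real.exp (-k * (p.2 - b.im) ^ 2)) := by
    intro p
    rw [← ENNReal.ofReal_mul (Real.exp_pos _).le, ← Real.exp_add, Complex.sq_norm,
      Complex.normSq_apply]
    congr 2
    simp [Complex.measurableEquivRealProd]
    ring
  simp_rw [this]
  rw [lintegral_prod_mul (f := fun x : ℝ => ENNReal.ofReal (Real.exp (-k * (x - b.re) ^ 2)))
    (g := fun x : ℝ => ENNReal.ofReal (Real.exp (-k * (x - b.im) ^ 2))) (by fun_prop) (by fun_prop),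
    lintegral_exp_neg_mul_sq_sub_gaussianReal hk,
    lintegral_exp_neg_mul_sq_sub_gaussianReal hk, ← ENNReal.ofReal_mul (by positivity)]
  congr 1
  rw [mul_mul_mul_comm, ← mul_inv, Real.mul_self_sqrt hk1.le, ← Real.exp_add, Complex.sq_norm,
    Complex.normSq_apply]
  congr 2
  ring

theorem memLp_id_complexGaussian : MemLp (fun z : ℂ => z) 2 complexGaussian := by
  have h1 : MemLp (fun x : ℝ => (x : ℂ)) 2 (gaussianReal 0 (1 / 2)) :=
    (memLp_id_gaussianReal 2).ofReal
  have h2 : MemLp (fun p : ℝ × ℝ => ((p.1 : ℂ) + p.2 * Complex.I)) 2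
      ((gaussianReal 0 (1 / 2)).prod (gaussianReal 0 (1 / 2))) := by
    refine MemLp.add (h1.comp_fst _) ?_
    exact (h1.comp_snd _).mul_const Complex.I
  rw [← measurePreserving_complexGaussian.map_eq,
    memLp_map_measure_iff (by fun_prop) (by fun_prop)]
  convert h2 using 2 with p
  apply Complex.ext <;> simp [Complex.measurableEquivRealProd]

theorem integral_id_complexGaussian : ∫ z, z ∂complexGaussian = 0 := by
  rw [← measurePreserving_complexGaussian.integral_comp
    Complex.measurableEquivRealProd.symm.measurableEmbedding]
  have : ∀ p : ℝ × ℝ, Complex.measurableEquivRealProd.symm p = (p.1 : ℂ) + p.2 * Complex.I :=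
    fun p => by apply Complex.ext <;> simp [Complex.measurableEquivRealProd]
  have h1 : Integrable (fun x : ℝ => (x : ℂ)) (gaussianReal 0 (1 / 2)) :=
    ((memLp_id_gaussianReal 1).integrable le_rfl).ofReal
  simp_rw [this]
  rw [integral_add (h1.comp_fst _) ((h1.comp_snd _).mul_const _), integral_mul_const,
    integral_fun_fst (fun x : ℝ => (x : ℂ)), integral_fun_snd (fun x : ℝ => (x : ℂ)),
    integral_complex_ofReal, integral_id_gaussianReal]
  simp

theorem integral_sq_gaussianReal_zero_half : ∫ x, x ^ 2 ∂(gaussianReal 0 (1 / 2)) = 1 / 2 := by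
  have h := variance_id_gaussianReal (μ := 0) (v := 1 / 2)
  rw [variance_eq_integral (by fun_prop)] at h
  simpa using h

theorem integral_mul_conj_complexGaussian :
    ∫ z, z * (starRingEnd ℂ) z ∂complexGaussian = 1 := by
  rw [← measurePreserving_complexGaussian.integral_comp
    Complex.measurableEquivRealProd.symm.measurableEmbedding]
  have : ∀ p : ℝ × ℝ, Complex.measurableEquivRealProd.symm p *
      (starRingEnd ℂ) (Complex.measurableEquivRealProd.symm p) =
        ((p.1 ^ 2 : ℝ) : ℂ) + ((p.2 ^ 2 : ℝ) : ℂ) := fun p => by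
    rw [Complex.mul_conj, ← Complex.ofReal_add, Complex.normSq_apply]
    simp [Complex.measurableEquivRealProd, sq]
  have h1 : Integrable (fun x : ℝ => ((x ^ 2 : ℝ) : ℂ)) (gaussianReal 0 (1 / 2)) :=
    ((memLp_id_gaussianReal 2).integrable_sq).ofReal
  simp_rw [this]
  rw [integral_add (h1.comp_fst _) (h1.comp_snd _),
    integral_fun_fst (fun x : ℝ => ((x ^ 2 : ℝ) : ℂ)),
    integral_fun_snd (fun x : ℝ => ((x ^ 2 : ℝ) : ℂ)),
    integral_complex_ofReal, integral_sq_gaussianReal_zero_half]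
  norm_num

/-! ### The Ginibre ensemble as a product measure. -/

/-- The law of the rows of an `n × n` complex Ginibre matrix. -/
noncomputable def ginibreMeasure (n : ℕ) : Measure (Fin n → Fin n → ℂ) :=
  Measure.pi fun _ => Measure.pi fun _ => complexGaussian

instance isProbabilityMeasure_ginibreMeasure (n : ℕ) :
    IsProbabilityMeasure (ginibreMeasure n) := by
  unfold ginibreMeasure
  infer_instance

theorem measurePreserving_curry_pi {ι κ X : Type*} [Fintype ι] [Fintype κ] [MeasurableSpace X]
    (μ : Measure X) [IsProbabilityMeasure μ] :
    MeasurePreserving (MeasurableEquiv.curry ι κ X) (Measure.pi fun _ => μ)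
      (Measure.pi fun _ => Measure.pi fun _ => μ) := by
  refine ⟨(MeasurableEquiv.curry ι κ X).measurable, ?_⟩
  have h := Measure.infinitePi_map_curry (ι := ι) (κ := κ) (fun _ _ => μ)
  simpa only [Measure.infinitePi_eq_pi] using h

theorem measurePreserving_ginibre (n : ℕ) :
    MeasurePreserving
      (fun (x : (Fin n × Fin n) ⊕ (Fin n × Fin n) → ℝ) (i j : Fin n) =>
        Complex.measurableEquivRealProd.symm (x (Sum.inl (i, j)), x (Sum.inr (i, j))))
      (Measure.pi fun _ => gaussianReal 0 (1 / 2)) (ginibreMeasure n) := by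
  have h1 := measurePreserving_sumPiEquivProdPi (ι := Fin n × Fin n) (ι' := Fin n × Fin n)
    (X := fun _ => ℝ) (fun _ => gaussianReal 0 (1 / 2))
  have h2 := (measurePreserving_arrowProdEquivProdArrow ℝ ℝ (Fin n × Fin n)
    (fun _ => gaussianReal 0 (1 / 2)) (fun _ => gaussianReal 0 (1 / 2))).symm
  have h3 := measurePreserving_pi (ι := Fin n × Fin n) _ _
    (fun _ => measurePreserving_complexGaussian)
  exact (measurePreserving_curry_pi complexGaussian).comp (h3.comp (h2.comp h1))

section IsGinibre

variable {Ω : Type*} [MeasurableSpace Ω] {P : Measure Ω} {n : ℕ}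
  {M : Ω → Matrix (Fin n) (Fin n) ℂ}

theorem IsGinibre.aemeasurable_entry (hM : IsGinibre P M) (i j : Fin n) :
    AEMeasurable (fun ω => M ω i j) P := by
  have h := ((hM.hasLaw_re i j).aemeasurable.prodMk (hM.hasLaw_im i j).aemeasurable)
  exact Complex.measurableEquivRealProd.symm.measurable.comp_aemeasurable h

theorem IsGinibre.aemeasurable (hM : IsGinibre P M) :
    AEMeasurable (fun ω i j => M ω i j) P :=
  aemeasurable_pi_lambda _ fun i => aemeasurable_pi_lambda _ fun j => hM.aemeasurable_entry i j

theorem IsGinibre.map_eq [IsProbabilityMeasure P] (hM : IsGinibre P M) :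
    P.map (fun ω i j => M ω i j) = ginibreMeasure n := by
  have hlaw : ∀ k : (Fin n × Fin n) ⊕ (Fin n × Fin n), HasLaw (fun ω =>
      Sum.elim (fun ij : Fin n × Fin n => (M ω ij.1 ij.2).re)
        (fun ij => (M ω ij.1 ij.2).im) k) (gaussianReal 0 (1 / 2)) P := by
    rintro (k | k)
    · exact hM.hasLaw_re _ _
    · exact hM.hasLaw_im _ _
  have h := (iIndepFun_iff_map_fun_eq_pi_map fun k => (hlaw k).aemeasurable).1 hM.indep
  simp_rw [fun k => (hlaw k).map_eq] at h
  rw [← (measurePreserving_ginibre n).map_eq, ← h, AEMeasurable.map_map_of_aemeasurable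
    (measurePreserving_ginibre n).measurable.aemeasurable
    (aemeasurable_pi_lambda _ fun k => (hlaw k).aemeasurable)]
  rfl

end IsGinibre

/-! ### Gaussian averages over one row. -/

theorem lintegral_exp_neg_norm_mul_sub_sq_div (α c : ℂ) {s : ℝ} (hs : 0 < s) :
    ∫⁻ g, ENNReal.ofReal (Real.exp (-(‖α * g - c‖ ^ 2 / s))) ∂complexGaussian =
      ENNReal.ofReal (s / (s + ‖α‖ ^ 2) * Real.exp (-(‖c‖ ^ 2 / (s + ‖α‖ ^ 2)))) := by
  rcases eq_or_ne α 0 with rfl | hα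
  · simp [div_self hs.ne']
  · have hα' : 0 < ‖α‖ := norm_pos_iff.2 hα
    have hk : 0 ≤ ‖α‖ ^ 2 / s := by positivity
    have h := lintegral_exp_neg_mul_norm_sub_sq_complexGaussian hk (c / α)
    have e1 : ∀ g : ℂ, -(‖α * g - c‖ ^ 2 / s) = -(‖α‖ ^ 2 / s) * ‖g - c / α‖ ^ 2 := by
      intro g
      rw [show α * g - c = α * (g - c / α) by field_simp, norm_mul]
      ring
    simp_rw [e1]
    rw [h, norm_div]
    congr 2
    · field_simp
    · congr 2
      field_simp

/-- The sum `∑ g j * φ j` is a centred complex Gaussian of variance `∑ ‖φ j‖²`. The shift `c` and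
the width `s` make the induction close: integrating out the last `n` coordinates shifts `c` by a
multiple of the first one and enlarges `s` by their variance. -/
theorem lintegral_exp_neg_norm_sum_sub_sq_div {n : ℕ} (φ : Fin n → ℂ) (c : ℂ) {s : ℝ}
    (hs : 0 < s) :
    ∫⁻ g, ENNReal.ofReal (Real.exp (-(‖∑ j, g j * φ j - c‖ ^ 2 / s)))
        ∂(Measure.pi fun _ : Fin n => complexGaussian) =
      ENNReal.ofReal (s / (s + ∑ j, ‖φ j‖ ^ 2) *
        Real.exp (-(‖c‖ ^ 2 / (s + ∑ j, ‖φ j‖ ^ 2)))) := by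
  induction n generalizing c with
  | zero => simp [div_self hs.ne']
  | succ n ih =>
    have hmp := (measurePreserving_piFinSuccAbove (n := n)
      (fun _ : Fin (n + 1) => complexGaussian) 0).symm
    rw [← hmp.lintegral_comp (by fun_prop), lintegral_prod _ (by fun_prop)]
    have hR : 0 < s + ∑ j : Fin n, ‖φ j.succ‖ ^ 2 := by positivity
    have e1 : ∀ (x : ℂ) (y : Fin n → ℂ),
        ∑ j, (MeasurableEquiv.piFinSuccAbove (fun _ : Fin (n + 1) => ℂ) 0).symm (x, y) j * φ j - c =
          ∑ j : Fin n, y j * φ j.succ - (c - x * φ 0) := by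
      intro x y
      rw [Fin.sum_univ_succ]
      simp [MeasurableEquiv.piFinSuccAbove]
      ring
    simp_rw [e1, ih (fun j => φ j.succ)]
    have e2 : ∀ x : ℂ, ENNReal.ofReal (s / (s + ∑ j : Fin n, ‖φ j.succ‖ ^ 2) *
        Real.exp (-(‖c - x * φ 0‖ ^ 2 / (s + ∑ j : Fin n, ‖φ j.succ‖ ^ 2)))) =
        ENNReal.ofReal (s / (s + ∑ j : Fin n, ‖φ j.succ‖ ^ 2)) * ENNReal.ofReal
        (Real.exp (-(‖φ 0 * x - c‖ ^ 2 / (s + ∑ j : Fin n, ‖φ j.succ‖ ^ 2)))) := by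
      intro x
      rw [← ENNReal.ofReal_mul (by positivity), norm_sub_rev, mul_comm x]
    simp_rw [e2]
    rw [lintegral_const_mul _ (by fun_prop), lintegral_exp_neg_norm_mul_sub_sq_div _ _ hR,
      ← ENNReal.ofReal_mul (by positivity), Fin.sum_univ_succ, ← mul_assoc,
      show s + (‖φ 0‖ ^ 2 + ∑ j : Fin n, ‖φ j.succ‖ ^ 2) =
        s + ∑ j : Fin n, ‖φ j.succ‖ ^ 2 + ‖φ 0‖ ^ 2 by ring]
    congr 2
    field_simp

/-! ### Gaussian integrals over `ℂ^n`. -/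

section GaussianIntegral

open scoped ComplexOrder

open scoped MatrixOrder in
theorem Matrix.PosSemidef.exists_eq_conjTranspose_mul_self {n : ℕ}
    {K : Matrix (Fin n) (Fin n) ℂ} (hK : K.PosSemidef) : ∃ B, K = B.conjTranspose * B :=
  CStarAlgebra.nonneg_iff_eq_star_mul_self.1 hK.nonneg

theorem finrank_real_euclideanSpace_complex (n : ℕ) :
    Module.finrank ℝ (EuclideanSpace ℂ (Fin n)) = 2 * n := by
  rw [← Module.finrank_mul_finrank ℝ ℂ]
  simp

theorem lintegral_exp_neg_norm_sq (n : ℕ) :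
    ∫⁻ φ : EuclideanSpace ℂ (Fin n), ENNReal.ofReal (Real.exp (-‖φ‖ ^ 2)) =
      ENNReal.ofReal (Real.pi ^ n) := by
  have h := GaussianFourier.integral_rexp_neg_mul_sq_norm (V := EuclideanSpace ℂ (Fin n)) one_pos
  have hi : Integrable fun φ : EuclideanSpace ℂ (Fin n) => Real.exp (-1 * ‖φ‖ ^ 2) := by
    refine Integrable.of_integral_ne_zero ?_
    rw [h]
    positivity
  rw [finrank_real_euclideanSpace_complex] at h
  simp only [neg_mul, one_mul] at h hi
  rw [← ofReal_integral_eq_lintegral_ofReal hi (Eventually.of_forall fun _ => (Real.exp_pos _).le),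
    h]
  congr 1
  simp

/-- Linear change of variables: a complex-linear map of complex determinant `d` has real determinant
`‖d‖ ^ 2`. -/
theorem lintegral_exp_neg_norm_toEuclideanLin_sq {n : ℕ} {B : Matrix (Fin n) (Fin n) ℂ}
    (hB : B.det ≠ 0) :
    ∫⁻ φ : EuclideanSpace ℂ (Fin n), ENNReal.ofReal (Real.exp (-‖B.toEuclideanLin φ‖ ^ 2)) =
      ENNReal.ofReal (Real.pi ^ n / ‖B.det‖ ^ 2) := by
  have hdet : LinearMap.det (B.toEuclideanLin.restrictScalars ℝ) = ‖B.det‖ ^ 2 := by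
    have h1 : LinearMap.det B.toEuclideanLin = B.det := by
      change LinearMap.det (Matrix.toLpLin 2 2 B) = B.det
      rw [Matrix.toLpLin_eq_toLin, LinearMap.det_toLin]
    rw [LinearMap.det_restrictScalars, h1, Algebra.norm_complex_apply, Complex.sq_norm]
  have hne : LinearMap.det (B.toEuclideanLin.restrictScalars ℝ) ≠ 0 := by
    rw [hdet]
    positivity
  have hm : Measurable (B.toEuclideanLin.restrictScalars ℝ) :=
    (LinearMap.continuous_of_finiteDimensional _).measurable
  have h := Measure.map_linearMap_addHaar_eq_smul_addHaar
    (volume : Measure (EuclideanSpace ℂ (Fin n))) hne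
  have h2 := lintegral_map (μ := (volume : Measure (EuclideanSpace ℂ (Fin n))))
    (f := fun φ => ENNReal.ofReal (Real.exp (-‖φ‖ ^ 2))) (by fun_prop) hm
  rw [h, lintegral_smul_measure, lintegral_exp_neg_norm_sq, hdet, smul_eq_mul,
    ← ENNReal.ofReal_mul (abs_nonneg _), abs_of_nonneg (by positivity)] at h2
  rw [← div_eq_inv_mul] at h2
  exact h2.symm

/-- This turns an inverse determinant into an integral of exponentials of a quadratic form, which
can be averaged over the matrix. It follows from the factorization `K = Bᴴ B`. -/
theorem lintegral_exp_neg_posDef {n : ℕ} {K : Matrix (Fin n) (Fin n) ℂ} (hK : K.PosDef) :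
    ∫⁻ φ : EuclideanSpace ℂ (Fin n),
      ENNReal.ofReal (Real.exp (-(star φ.ofLp ⬝ᵥ K.mulVec φ.ofLp).re)) =
      ENNReal.ofReal (Real.pi ^ n / ‖K.det‖) := by
  obtain ⟨B, rfl⟩ := hK.posSemidef.exists_eq_conjTranspose_mul_self
  have hd : ‖(B.conjTranspose * B).det‖ = ‖B.det‖ ^ 2 := by
    rw [Matrix.det_mul, Matrix.det_conjTranspose, norm_mul, norm_star, sq]
  have hne : B.det ≠ 0 := by
    intro h
    have := hK.det_pos.ne'
    simp [Matrix.det_mul, h] at this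
  rw [hd, ← lintegral_exp_neg_norm_toEuclideanLin_sq hne]
  refine lintegral_congr fun φ => ?_
  congr 3
  rw [← Matrix.mulVec_mulVec, Matrix.dotProduct_mulVec, ← Matrix.star_mulVec, EuclideanSpace.norm_sq_eq]
  simp [dotProduct, Matrix.toLpLin_apply, ← Complex.normSq_eq_norm_sq, Complex.normSq_apply]

/-- The integral of `exp (-t ‖φ‖²) / ‖φ‖ ^ (2 k)` over `ℂ ^ (k + 1)`. -/
theorem lintegral_exp_neg_mul_norm_sq_div_norm_pow (k : ℕ) {t : ℝ} (ht : 0 < t) :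
    ∫⁻ φ : EuclideanSpace ℂ (Fin (k + 1)),
      ENNReal.ofReal (Real.exp (-t * ‖φ‖ ^ 2) * ((‖φ‖ ^ 2) ^ k)⁻¹) =
      ENNReal.ofReal (Real.pi ^ (k + 1) / (k.factorial * t)) := by
  -- The radial weight in real dimension `2 (k + 1)` is `y ^ (2 k + 1)`. Division by `y ^ (2 k)`
  -- leaves `y`, so the singularity at the origin is harmless.
  have hr : ∀ y ∈ Set.Ioi (0 : ℝ), y ^ (2 * (k + 1) - 1) •
      (Real.exp (-t * y ^ 2) * ((y ^ 2) ^ k)⁻¹) = y ^ (1 : ℝ) * Real.exp (-t * y ^ (2 : ℝ)) := by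
    intro y hy
    have hy : 0 < y := hy
    rw [Real.rpow_one, Real.rpow_two, smul_eq_mul, show 2 * (k + 1) - 1 = 2 * k + 1 by omega,
      pow_succ, pow_mul]
    field_simp
  have hint := (integrable_fun_norm_addHaar
    (volume : Measure (EuclideanSpace ℂ (Fin (k + 1))))
    (f := fun y => Real.exp (-t * y ^ 2) * ((y ^ 2) ^ k)⁻¹)).2 (by
      rw [finrank_real_euclideanSpace_complex]
      refine (integrableOn_congr_fun hr measurableSet_Ioi).2 ?_
      exact integrableOn_rpow_mul_exp_neg_mul_rpow (by norm_num) (by norm_num) ht)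
  rw [← ofReal_integral_eq_lintegral_ofReal hint (Eventually.of_forall fun _ => by positivity),
    integral_fun_norm_addHaar (volume : Measure (EuclideanSpace ℂ (Fin (k + 1))))
      (fun y => Real.exp (-t * y ^ 2) * ((y ^ 2) ^ k)⁻¹), finrank_real_euclideanSpace_complex,
    setIntegral_congr_fun measurableSet_Ioi hr,
    integral_rpow_mul_exp_neg_mul_rpow (by norm_num) (by norm_num) ht, Measure.real,
    InnerProductSpace.volume_ball_of_dim_even (finrank_real_euclideanSpace_complex (k + 1))]
  congr 1
  rw [ENNReal.ofReal_one, one_pow, one_mul, ENNReal.toReal_ofReal (by positivity),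
    show ((1 : ℝ) + 1) / 2 = 1 by norm_num, Real.Gamma_one,
    show (-(1 + 1) / 2 : ℝ) = -1 by norm_num, Real.rpow_neg_one, Nat.factorial_succ]
  simp only [smul_eq_mul, nsmul_eq_mul]
  push_cast
  field_simp

end GaussianIntegral

/-! ### The negative moment of the regularized determinant. -/

/-- The logarithmic potential of the uniform distribution on the unit disk. -/
noncomputable def diskPotential (z : ℂ) : ℝ :=
  if ‖z‖ ≤ 1 then (‖z‖ ^ 2 - 1) / 2 else Real.log ‖z‖

/-- Both cases are `x ≤ exp (x - 1)`, taken at `x = v` inside the disk and at `x = ‖z‖² v` outside.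
The bound is the exact maximum over `v ∈ [0, 1]`, attained at `v = 1` or at `v = 1 / ‖z‖²`; this is
how the disk potential enters the lower bound. -/
theorem mul_exp_neg_le_exp_neg_diskPotential (z : ℂ) {v : ℝ} (hv1 : v ≤ 1) :
    v * Real.exp (-(‖z‖ ^ 2 * v)) ≤ Real.exp (-(2 * diskPotential z + 1)) := by
  unfold diskPotential
  split_ifs with h
  · have h2 : ‖z‖ ^ 2 ≤ 1 := by nlinarith [norm_nonneg z]
    have h3 : v ≤ Real.exp (v - 1) := by linarith [Real.add_one_le_exp (v - 1)]
    calc v * Real.exp (-(‖z‖ ^ 2 * v)) ≤ Real.exp (v - 1) * Real.exp (-(‖z‖ ^ 2 * v)) := by gcongr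
      _ = Real.exp (v - 1 - ‖z‖ ^ 2 * v) := by rw [← Real.exp_add]; ring_nf
      _ ≤ _ := Real.exp_le_exp.2 (by nlinarith)
  · have hz : 1 < ‖z‖ := not_le.1 h
    have hz0 : 0 < ‖z‖ := by linarith
    have h3 : ‖z‖ ^ 2 * v ≤ Real.exp (‖z‖ ^ 2 * v - 1) := by
      linarith [Real.add_one_le_exp (‖z‖ ^ 2 * v - 1)]
    have h4 : Real.exp (-(2 * Real.log ‖z‖ + 1)) = (‖z‖ ^ 2)⁻¹ * Real.exp (-1) := by
      rw [neg_add, Real.exp_add, Real.exp_neg, show 2 * Real.log ‖z‖ = Real.log (‖z‖ ^ 2) by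
        simp, Real.exp_log (by positivity)]
    rw [h4, inv_mul_eq_div, le_div_iff₀ (by positivity)]
    calc v * Real.exp (-(‖z‖ ^ 2 * v)) * ‖z‖ ^ 2
        = (‖z‖ ^ 2 * v) * Real.exp (-(‖z‖ ^ 2 * v)) := by ring
      _ ≤ Real.exp (‖z‖ ^ 2 * v - 1) * Real.exp (-(‖z‖ ^ 2 * v)) := by gcongr
      _ = _ := by rw [← Real.exp_add]; ring_nf

section NegativeMoment

open scoped ComplexOrder

/-- The positive definite matrix `(A - ζ)ᴴ (A - ζ) + t`. -/
noncomputable def shiftedGram {n : ℕ} (A : Fin n → Fin n → ℂ) (ζ : ℂ) (t : ℝ) :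
    Matrix (Fin n) (Fin n) ℂ :=
  (Matrix.of A - ζ • 1).conjTranspose * (Matrix.of A - ζ • 1) + (t : ℂ) • 1

theorem posDef_shiftedGram {n : ℕ} (A : Fin n → Fin n → ℂ) (ζ : ℂ) {t : ℝ} (ht : 0 < t) :
    (shiftedGram A ζ t).PosDef := by
  rw [shiftedGram, add_comm]
  refine Matrix.PosDef.add_posSemidef ?_ (Matrix.posSemidef_conjTranspose_mul_self _)
  exact Matrix.PosDef.one.smul (by exact_mod_cast ht)

theorem re_dotProduct_shiftedGram_mulVec {n : ℕ} (A : Fin n → Fin n → ℂ) (ζ : ℂ) (t : ℝ)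
    (φ : Fin n → ℂ) :
    (star φ ⬝ᵥ (shiftedGram A ζ t).mulVec φ).re =
      ∑ i, ‖∑ j, A i j * φ j - ζ * φ i‖ ^ 2 + t * ∑ i, ‖φ i‖ ^ 2 := by
  have h1 : (Matrix.of A - ζ • 1).mulVec φ = fun i => ∑ j, A i j * φ j - ζ * φ i := by
    ext i
    rw [Matrix.sub_mulVec, Matrix.smul_mulVec, Matrix.one_mulVec]
    simp [Matrix.mulVec, dotProduct]
  have h2 : ∀ v : Fin n → ℂ, (star v ⬝ᵥ v).re = ∑ i, ‖v i‖ ^ 2 := fun v => by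
    simp [dotProduct, ← Complex.normSq_eq_norm_sq, Complex.normSq_apply]
  rw [shiftedGram, Matrix.add_mulVec, dotProduct_add, Complex.add_re, ← Matrix.mulVec_mulVec,
    Matrix.dotProduct_mulVec, ← Matrix.star_mulVec, h2, h1, Matrix.smul_mulVec,
    Matrix.one_mulVec, dotProduct_smul, smul_eq_mul, Complex.re_ofReal_mul, h2]

theorem lintegral_prod_ginibreMeasure {n : ℕ} (f : Fin n → (Fin n → ℂ) → ℝ≥0∞)
    (hf : ∀ i, Measurable (f i)) :
    ∫⁻ A, ∏ i, f i (A i) ∂(ginibreMeasure n) =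
      ∏ i, ∫⁻ g, f i g ∂(Measure.pi fun _ => complexGaussian) := by
  have hind : iIndepFun (fun i (A : Fin n → Fin n → ℂ) => f i (A i)) (ginibreMeasure n) :=
    iIndepFun_pi fun i => (hf i).aemeasurable
  rw [lintegral_prod_eq_prod_lintegral_of_indepFun _ _ hind
    fun i => (hf i).comp (measurable_pi_apply i)]
  refine Finset.prod_congr rfl fun i _ => ?_
  exact (measurePreserving_eval (fun _ : Fin n => Measure.pi fun _ : Fin n => complexGaussian)
    i).lintegral_comp (hf i)

/-- The rows are independent, and row `i` contributes the one-row average with width `1` and shift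
`ζ * φ i`. -/
theorem lintegral_exp_neg_norm_mulVec_sub_sq {n : ℕ} (φ : Fin n → ℂ) (ζ : ℂ) :
    ∫⁻ A, ENNReal.ofReal (Real.exp (-∑ i, ‖∑ j, A i j * φ j - ζ * φ i‖ ^ 2))
        ∂(ginibreMeasure n) =
      ENNReal.ofReal ((1 / (1 + ∑ j, ‖φ j‖ ^ 2)) ^ n *
        Real.exp (-(‖ζ‖ ^ 2 * (∑ j, ‖φ j‖ ^ 2) / (1 + ∑ j, ‖φ j‖ ^ 2)))) := by
  have h1 : ∀ A : Fin n → Fin n → ℂ,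
      ENNReal.ofReal (Real.exp (-∑ i, ‖∑ j, A i j * φ j - ζ * φ i‖ ^ 2)) =
      ∏ i, ENNReal.ofReal (Real.exp (-(‖∑ j, A i j * φ j - ζ * φ i‖ ^ 2 / 1))) := by
    intro A
    rw [← ENNReal.ofReal_prod_of_nonneg fun _ _ => (Real.exp_pos _).le, ← Real.exp_sum,
      Finset.sum_neg_distrib]
    simp
  simp_rw [h1]
  rw [lintegral_prod_ginibreMeasure
    (fun i g => ENNReal.ofReal (Real.exp (-(‖∑ j, g j * φ j - ζ * φ i‖ ^ 2 / 1))))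
    fun i => by fun_prop]
  simp_rw [lintegral_exp_neg_norm_sum_sub_sq_div φ _ one_pos]
  rw [← ENNReal.ofReal_prod_of_nonneg fun _ _ => by positivity, Finset.prod_mul_distrib,
    Finset.prod_const, Finset.card_univ, Fintype.card_fin, ← Real.exp_sum,
    Finset.sum_neg_distrib, ← Finset.sum_div]
  simp_rw [norm_mul, mul_pow, ← Finset.mul_sum]

/-- With `v = u / (1 + u)`, the left side is `(v exp (-‖z‖² v)) ^ k * u ^ (-k)` times a leftover
factor at most `1`. Only `k` of the `k + 1` factors are converted, because `u ^ (-k)` with `u =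
‖φ‖²` is locally integrable on `ℂ ^ (k + 1)` whereas `u ^ (-(k + 1))` is not. -/
theorem inv_one_add_pow_mul_exp_le (k : ℕ) (z : ℂ) {u : ℝ} (hu : 0 < u) :
    (1 / (1 + u)) ^ (k + 1) * Real.exp (-(‖(√(k + 1 : ℝ) : ℂ) * z‖ ^ 2 * u / (1 + u))) ≤
      Real.exp (-(2 * diskPotential z + 1)) ^ k * (u ^ k)⁻¹ := by
  have hv := mul_exp_neg_le_exp_neg_diskPotential z (v := u / (1 + u))
    ((div_le_one (by positivity)).2 (by linarith))
  have hk := pow_le_pow_left₀ (by positivity) hv k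
  have hn : ‖(√(k + 1 : ℝ) : ℂ) * z‖ ^ 2 = (k + 1) * ‖z‖ ^ 2 := by
    rw [norm_mul, mul_pow, Complex.norm_real, Real.norm_eq_abs, sq_abs,
      Real.sq_sqrt (by positivity)]
  have he : Real.exp (-((k + 1) * ‖z‖ ^ 2 * u / (1 + u))) =
      Real.exp (-(‖z‖ ^ 2 * (u / (1 + u)))) ^ k * Real.exp (-(‖z‖ ^ 2 * (u / (1 + u)))) := by
    rw [← Real.exp_nat_mul, ← Real.exp_add]
    congr 1
    ring
  have h1 : 1 / (1 + u) ≤ 1 := (div_le_one (by positivity)).2 (by linarith)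
  have h2 : Real.exp (-(‖z‖ ^ 2 * (u / (1 + u)))) ≤ 1 := by
    rw [Real.exp_le_one_iff, neg_nonpos]
    positivity
  rw [hn, he, ← div_eq_mul_inv, le_div_iff₀ (by positivity)]
  calc (1 / (1 + u)) ^ (k + 1) * (Real.exp (-(‖z‖ ^ 2 * (u / (1 + u)))) ^ k *
        Real.exp (-(‖z‖ ^ 2 * (u / (1 + u))))) * u ^ k
      = (u / (1 + u) * Real.exp (-(‖z‖ ^ 2 * (u / (1 + u))))) ^ k *
          (1 / (1 + u) * Real.exp (-(‖z‖ ^ 2 * (u / (1 + u))))) := by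
        rw [mul_pow, div_pow, div_pow, div_eq_mul_inv (1 : ℝ), pow_succ]
        simp only [one_pow]
        field_simp
        ring
    _ ≤ (u / (1 + u) * Real.exp (-(‖z‖ ^ 2 * (u / (1 + u))))) ^ k * 1 := by
        gcongr
        exact mul_le_one₀ h1 (Real.exp_pos _).le h2
    _ ≤ _ := by rwa [mul_one]

/-- The inverse determinant is written as a Gaussian integral over `φ`, and Tonelli allows the
matrix to be averaged first. The average depends on `‖φ‖` only, and `t` supplies the decay `exp (-t
‖φ‖²)` that makes the remaining radial integral finite. -/
theorem lintegral_inv_norm_det_shiftedGram_le (k : ℕ) (z : ℂ) {t : ℝ} (ht : 0 < t) :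
    ∫⁻ A, ENNReal.ofReal ‖(shiftedGram A ((√(k + 1 : ℝ) : ℂ) * z) t).det‖⁻¹
        ∂(ginibreMeasure (k + 1)) ≤
      ENNReal.ofReal (Real.exp (-(2 * diskPotential z + 1)) ^ k / (k.factorial * t)) := by
  set ζ : ℂ := (√(k + 1 : ℝ) : ℂ) * z with hζ
  have hπ : (0 : ℝ) < Real.pi ^ (k + 1) := by positivity
  have hrep : ∀ A : Fin (k + 1) → Fin (k + 1) → ℂ,
      ENNReal.ofReal (Real.pi ^ (k + 1)) * ENNReal.ofReal ‖(shiftedGram A ζ t).det‖⁻¹ =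
        ∫⁻ φ : EuclideanSpace ℂ (Fin (k + 1)), ENNReal.ofReal (Real.exp (-t * ‖φ‖ ^ 2)) *
          ENNReal.ofReal (Real.exp (-∑ i, ‖∑ j, A i j * φ j - ζ * φ i‖ ^ 2)) := by
    intro A
    rw [← ENNReal.ofReal_mul hπ.le, ← div_eq_mul_inv,
      ← lintegral_exp_neg_posDef (posDef_shiftedGram A ζ ht)]
    refine lintegral_congr fun φ => ?_
    rw [re_dotProduct_shiftedGram_mulVec, ← ENNReal.ofReal_mul (Real.exp_pos _).le,
      ← Real.exp_add, EuclideanSpace.norm_sq_eq]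
    congr 2
    ring
  have hmain : ∫⁻ A, ENNReal.ofReal (Real.pi ^ (k + 1)) *
      ENNReal.ofReal ‖(shiftedGram A ζ t).det‖⁻¹ ∂(ginibreMeasure (k + 1)) ≤
      ENNReal.ofReal (Real.exp (-(2 * diskPotential z + 1)) ^ k) *
        ENNReal.ofReal (Real.pi ^ (k + 1) / (k.factorial * t)) := by
    simp_rw [hrep]
    rw [lintegral_lintegral_swap (Measurable.aemeasurable (by fun_prop)),
      ← lintegral_exp_neg_mul_norm_sq_div_norm_pow k ht, ← lintegral_const_mul _ (by fun_prop)]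
    have hne : ∀ᵐ φ : EuclideanSpace ℂ (Fin (k + 1)), φ ≠ 0 := by
      simp [ae_iff]
    refine lintegral_mono_ae (hne.mono fun φ hφ => ?_)
    rw [lintegral_const_mul _ (by fun_prop), lintegral_exp_neg_norm_mulVec_sub_sq,
      ← ENNReal.ofReal_mul (Real.exp_pos _).le, ← ENNReal.ofReal_mul (by positivity)]
    refine ENNReal.ofReal_le_ofReal ?_
    rw [← EuclideanSpace.norm_sq_eq,
      mul_left_comm (Real.exp (-(2 * diskPotential z + 1)) ^ k)]
    exact mul_le_mul_of_nonneg_left (inv_one_add_pow_mul_exp_le k z (by positivity))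
      (Real.exp_pos _).le
  rw [lintegral_const_mul' _ _ ENNReal.ofReal_ne_top,
    ← ENNReal.ofReal_mul (by positivity), ← mul_div_assoc, mul_comm _ (Real.pi ^ (k + 1)),
    mul_div_assoc, ENNReal.ofReal_mul hπ.le] at hmain
  exact (ENNReal.mul_le_mul_iff_right (by simpa using hπ) ENNReal.ofReal_ne_top).1 hmain

end NegativeMoment

/-! ### Anti-concentration: bounds on the entries of the inverse. -/

section AntiConcentration

theorem measure_pi_le_of_forall_update {ι : Type*} [Fintype ι] [DecidableEq ι] {X : ι → Type*}
    [∀ i, MeasurableSpace (X i)] (μ : ∀ i, Measure (X i)) [∀ i, IsProbabilityMeasure (μ i)]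
    {s : Set (∀ i, X i)} (hs : MeasurableSet s) (i : ι) {c : ℝ≥0∞}
    (h : ∀ x : ∀ i, X i, μ i {y | Function.update x i y ∈ s} ≤ c) : Measure.pi μ s ≤ c := by
  have h1 : ∫⁻ x, s.indicator 1 x ∂(Measure.pi μ) ≤ ∫⁻ _, c ∂(Measure.pi μ) := by
    refine lintegral_le_of_lmarginal_le {i} (measurable_one.indicator hs) measurable_const ?_
    intro x
    simp only [lmarginal_singleton]
    have h2 : ∀ y, s.indicator (1 : (∀ i, X i) → ℝ≥0∞) (Function.update x i y) =
        (Function.update x i ⁻¹' s).indicator 1 y := fun y => rfl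
    simp_rw [h2]
    rw [lintegral_indicator_one (measurable_update x hs), lintegral_const, measure_univ, mul_one]
    exact h x
  rwa [lintegral_indicator_one hs, lintegral_const, measure_univ, mul_one] at h1

theorem measurable_matrix_det_sub {n : ℕ} (ζ : ℂ) :
    Measurable fun A : Fin n → Fin n → ℂ => (Matrix.of A - ζ • 1).det := by
  simp_rw [Matrix.det_apply, Matrix.sub_apply, Matrix.of_apply]
  fun_prop

theorem measurable_matrix_adjugate_sub {n : ℕ} (ζ : ℂ) (i j : Fin n) :
    Measurable fun A : Fin n → Fin n → ℂ => (Matrix.of A - ζ • 1).adjugate i j := by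
  have : Continuous fun A : Fin n → Fin n → ℂ => (Matrix.of A - ζ • 1).adjugate i j := by
    have h : Continuous fun A : Fin n → Fin n → ℂ => (Matrix.of A - ζ • 1) :=
      Continuous.sub (continuous_id (X := Fin n → Fin n → ℂ)) continuous_const
    exact (h.matrix_adjugate).matrix_elem i j
  exact this.measurable

theorem Matrix.adjugate_updateRow_self_apply {n : ℕ} (B : Matrix (Fin n) (Fin n) ℂ)
    (i j : Fin n) (v : Fin n → ℂ) : (B.updateRow i v).adjugate j i = B.adjugate j i := by
  rw [Matrix.adjugate_apply, Matrix.adjugate_apply, Matrix.updateRow_idem]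

theorem Matrix.det_updateRow_add_single {n : ℕ} (B : Matrix (Fin n) (Fin n) ℂ) (i j : Fin n)
    (y : ℂ) : (B.updateRow i (B i + y • Pi.single j 1)).det = B.det + y * B.adjugate j i := by
  rw [Matrix.det_updateRow_add, Matrix.det_updateRow_smul, Matrix.updateRow_eq_self,
    Matrix.adjugate_apply]

/-- For `α ≠ 0` the event puts `y` in the disk of radius `1 / R` around `-β / α`, whose mass is at
most `1 / R²` because the density is at most `1 / π`. -/
theorem complexGaussian_norm_affine_lt_le (α β : ℂ) {R : ℝ} (hR : 0 < R) :
    complexGaussian {y | R * ‖β + y * α‖ < ‖α‖} ≤ ENNReal.ofReal R⁻¹ ^ 2 := by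
  rcases eq_or_ne α 0 with rfl | hα
  · have : {y : ℂ | R * ‖β + y * 0‖ < ‖(0 : ℂ)‖} = ∅ := by
      ext y
      simp only [Set.mem_ofPred_eq, norm_zero, Set.mem_empty_iff_false, iff_false, not_lt]
      positivity
    rw [this]
    simp
  · refine le_trans (measure_mono ?_) (complexGaussian_closedBall_le (-(β / α)) R⁻¹)
    intro y hy
    have hα' : 0 < ‖α‖ := norm_pos_iff.2 hα
    have hy : R * ‖β + y * α‖ < ‖α‖ := hy
    rw [Metric.mem_closedBall, dist_eq_norm, sub_neg_eq_add]
    rw [show β + y * α = (y + β / α) * α by field_simp; ring, norm_mul] at hy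
    rw [← one_div, le_div_iff₀ hR]
    nlinarith

/-- With all other entries frozen, the determinant is affine in the entry `(i, j)`, with slope the
cofactor `adjugate j i`, which does not involve that entry. -/
theorem ginibreMeasure_det_lt_adjugate_le {n : ℕ} (ζ : ℂ) (i j : Fin n) {R : ℝ} (hR : 0 < R) :
    ginibreMeasure n {A | R * ‖(Matrix.of A - ζ • 1).det‖ <
      ‖(Matrix.of A - ζ • 1).adjugate j i‖} ≤ ENNReal.ofReal R⁻¹ ^ 2 := by
  have hmeas : MeasurableSet {A : Fin n → Fin n → ℂ | R * ‖(Matrix.of A - ζ • 1).det‖ <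
      ‖(Matrix.of A - ζ • 1).adjugate j i‖} :=
    measurableSet_lt ((measurable_matrix_det_sub ζ).norm.const_mul R)
      (measurable_matrix_adjugate_sub ζ j i).norm
  refine measure_pi_le_of_forall_update _ hmeas i fun A => ?_
  refine measure_pi_le_of_forall_update _ (measurable_update A hmeas) j fun r => ?_
  -- The base point of the affine family: the entry `(i, j)` before the shift by `ζ` is set to `0`.
  set B : Matrix (Fin n) (Fin n) ℂ :=
    Matrix.of (Function.update A i (Function.update r j 0)) - ζ • 1 with hB
  have key : ∀ y : ℂ, Matrix.of (Function.update A i (Function.update r j y)) - ζ • 1 =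
      B.updateRow i (B i + y • Pi.single j 1) := by
    intro y
    ext a b
    rcases eq_or_ne a i with rfl | ha
    · rcases eq_or_ne b j with rfl | hb
      · simp [hB]
        ring
      · simp [hB, hb]
    · simp [hB, ha]
  refine le_trans (measure_mono ?_) (complexGaussian_norm_affine_lt_le (B.adjugate j i) B.det hR)
  intro y hy
  have hy : R * ‖(Matrix.of (Function.update A i (Function.update r j y)) - ζ • 1).det‖ <
      ‖(Matrix.of (Function.update A i (Function.update r j y)) - ζ • 1).adjugate j i‖ := hy
  rwa [key, Matrix.det_updateRow_add_single, Matrix.adjugate_updateRow_self_apply] at hy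

end AntiConcentration

/-! ### Removing the regularization from the determinant. -/

section DetPerturbation

open scoped ComplexOrder

/-- Each eigenvalue satisfies `x ≤ exp (x - 1)`. -/
theorem Matrix.PosDef.norm_det_le_exp_trace_sub {n : ℕ} {K : Matrix (Fin n) (Fin n) ℂ}
    (hK : K.PosDef) : ‖K.det‖ ≤ Real.exp (K.trace.re - n) := by
  have hH := hK.isHermitian
  have h1 : K.trace.re = ∑ i, hH.eigenvalues i := by
    rw [hH.trace_eq_sum_eigenvalues]
    simp
  rw [hH.det_eq_prod_eigenvalues, norm_prod, h1]
  calc ∏ i, ‖((hH.eigenvalues i : ℝ) : ℂ)‖ ≤ ∏ i, Real.exp (hH.eigenvalues i - 1) := by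
        refine Finset.prod_le_prod (fun _ _ => norm_nonneg _) fun i _ => ?_
        rw [Complex.norm_real, Real.norm_eq_abs, abs_of_pos (hK.eigenvalues_pos i)]
        linarith [Real.add_one_le_exp (hH.eigenvalues i - 1)]
    _ = _ := by
        rw [← Real.exp_sum, Finset.sum_sub_distrib]
        simp

theorem Matrix.trace_conjTranspose_mul_self_re {n : ℕ} (C : Matrix (Fin n) (Fin n) ℂ) :
    (C.conjTranspose * C).trace.re = ∑ j, ∑ i, ‖C i j‖ ^ 2 := by
  simp [Matrix.trace, Matrix.mul_apply, ← Complex.normSq_eq_norm_sq, Complex.normSq_apply]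

/-- Factor `Bᴴ B + t = Bᴴ (1 + t B⁻ᴴ B⁻¹) B`. The middle determinant is at most the exponential of
`t` times the sum of the squared entries of `B⁻¹`, and these entries are adjugate over determinant,
hence at most `R`. -/
theorem norm_det_conjTranspose_mul_self_add_le {n : ℕ} {B : Matrix (Fin n) (Fin n) ℂ}
    (hB : B.det ≠ 0) {R t : ℝ} (hR : ∀ i j, ‖B.adjugate i j‖ ≤ R * ‖B.det‖) (ht : 0 ≤ t)
    (htR : t * (n * (n * R ^ 2)) ≤ 1) :
    ‖(B.conjTranspose * B + (t : ℂ) • 1).det‖ ≤ Real.exp 1 * ‖B.det‖ ^ 2 := by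
  have hunit : IsUnit B.det := isUnit_iff_ne_zero.2 hB
  have hdet : 0 < ‖B.det‖ := norm_pos_iff.2 hB
  have hfac : B.conjTranspose * B + (t : ℂ) • 1 =
      B.conjTranspose * (1 + (t : ℂ) • (B⁻¹.conjTranspose * B⁻¹)) * B := by
    have h1 : B.conjTranspose * B⁻¹.conjTranspose = 1 := by
      rw [← Matrix.conjTranspose_mul, Matrix.nonsing_inv_mul _ hunit, Matrix.conjTranspose_one]
    rw [mul_add, mul_one, add_mul, mul_smul_comm, smul_mul_assoc, ← mul_assoc, h1, one_mul,
      Matrix.nonsing_inv_mul _ hunit]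
  have hP : (1 + (t : ℂ) • (B⁻¹.conjTranspose * B⁻¹)).PosDef :=
    Matrix.PosDef.one.add_posSemidef
      ((Matrix.posSemidef_conjTranspose_mul_self _).smul (by exact_mod_cast ht))
  have htr : (1 + (t : ℂ) • (B⁻¹.conjTranspose * B⁻¹)).trace.re - n ≤ 1 := by
    rw [Matrix.trace_add, Matrix.trace_smul, Complex.add_re, smul_eq_mul, Complex.re_ofReal_mul,
      Matrix.trace_conjTranspose_mul_self_re, Matrix.trace_one]
    simp only [Fintype.card_fin, Complex.natCast_re, add_sub_cancel_left]
    refine le_trans ?_ htR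
    refine mul_le_mul_of_nonneg_left ?_ ht
    calc ∑ j, ∑ i, ‖B⁻¹ i j‖ ^ 2 ≤ ∑ _j : Fin n, ∑ _i : Fin n, R ^ 2 := by
          refine Finset.sum_le_sum fun j _ => Finset.sum_le_sum fun i _ => ?_
          refine pow_le_pow_left₀ (norm_nonneg _) ?_ 2
          rw [Matrix.inv_def, Matrix.smul_apply, smul_eq_mul, norm_mul, Ring.inverse_eq_inv',
            norm_inv, inv_mul_le_iff₀ hdet, mul_comm]
          exact hR i j
      _ = _ := by simp
  rw [hfac, Matrix.det_mul, Matrix.det_mul, Matrix.det_conjTranspose, norm_mul, norm_mul,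
    norm_star, mul_right_comm, ← sq, mul_comm]
  gcongr
  exact hP.norm_det_le_exp_trace_sub.trans (Real.exp_le_exp.2 htr)

end DetPerturbation

/-! ### The second moment of the determinant. -/

section SecondMoment

theorem memLp_eval_pi_complexGaussian {n : ℕ} (a : Fin n) :
    MemLp (fun g : Fin n → ℂ => g a) 2 (Measure.pi fun _ => complexGaussian) :=
  memLp_id_complexGaussian.comp_measurePreserving
    (measurePreserving_eval (fun _ : Fin n => complexGaussian) a)

theorem integral_eval_pi_complexGaussian {n : ℕ} (a : Fin n) :
    ∫ g : Fin n → ℂ, g a ∂(Measure.pi fun _ => complexGaussian) = 0 := by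
  rw [integral_comp_eval (μ := fun _ : Fin n => complexGaussian) (f := fun z : ℂ => z)
    (by fun_prop)]
  exact integral_id_complexGaussian

theorem integrable_eval_mul_conj_eval {n : ℕ} (a b : Fin n) :
    Integrable (fun g : Fin n → ℂ => g a * (starRingEnd ℂ) (g b))
      (Measure.pi fun _ => complexGaussian) :=
  (memLp_eval_pi_complexGaussian a).integrable_mul (memLp_eval_pi_complexGaussian b).star

theorem integral_eval_mul_conj_eval {n : ℕ} (a b : Fin n) :
    ∫ g : Fin n → ℂ, g a * (starRingEnd ℂ) (g b) ∂(Measure.pi fun _ => complexGaussian) =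
      if a = b then 1 else 0 := by
  split_ifs with h
  · subst h
    rw [integral_comp_eval (μ := fun _ : Fin n => complexGaussian)
      (f := fun z : ℂ => z * (starRingEnd ℂ) z) (by fun_prop)]
    exact integral_mul_conj_complexGaussian
  · have hind : iIndepFun (fun i (g : Fin n → ℂ) => g i)
        (Measure.pi fun _ : Fin n => complexGaussian) :=
      iIndepFun_pi (X := fun _ z => z) fun i => aemeasurable_id
    have h2 : IndepFun (fun g : Fin n → ℂ => g a) (fun g => (starRingEnd ℂ) (g b))
        (Measure.pi fun _ : Fin n => complexGaussian) :=
      (hind.indepFun h).comp measurable_id Complex.continuous_conj.measurable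
    rw [h2.integral_fun_mul_eq_mul_integral (memLp_eval_pi_complexGaussian a).1
      (memLp_eval_pi_complexGaussian b).star.1,
      integral_eval_pi_complexGaussian, zero_mul]

theorem memLp_eval_sub_const {n : ℕ} (a : Fin n) (c : ℂ) :
    MemLp (fun g : Fin n → ℂ => g a - c) 2 (Measure.pi fun _ => complexGaussian) :=
  (memLp_eval_pi_complexGaussian a).sub (memLp_const c)

theorem integrable_sub_mul_conj_sub {n : ℕ} (a b : Fin n) (c d : ℂ) :
    Integrable (fun g : Fin n → ℂ => (g a - c) * (starRingEnd ℂ) (g b - d))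
      (Measure.pi fun _ => complexGaussian) :=
  (memLp_eval_sub_const a c).integrable_mul (memLp_eval_sub_const b d).star

theorem integral_sub_mul_conj_sub {n : ℕ} (a b : Fin n) (c d : ℂ) :
    ∫ g : Fin n → ℂ, (g a - c) * (starRingEnd ℂ) (g b - d)
      ∂(Measure.pi fun _ => complexGaussian) = (if a = b then 1 else 0) +
        c * (starRingEnd ℂ) d := by
  have e : ∀ g : Fin n → ℂ, (g a - c) * (starRingEnd ℂ) (g b - d) =
      g a * (starRingEnd ℂ) (g b) - g a * (starRingEnd ℂ) d -
        (c * (starRingEnd ℂ) (g b - d)) := by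
    intro g
    rw [map_sub]
    ring
  have hb : Integrable (fun g : Fin n → ℂ => g b) (Measure.pi fun _ => complexGaussian) :=
    (memLp_eval_pi_complexGaussian b).integrable one_le_two
  have ha : Integrable (fun g : Fin n → ℂ => g a) (Measure.pi fun _ => complexGaussian) :=
    (memLp_eval_pi_complexGaussian a).integrable one_le_two
  have hd : ∫ g : Fin n → ℂ, (starRingEnd ℂ) (g b - d) ∂(Measure.pi fun _ => complexGaussian) =
      -(starRingEnd ℂ) d := by
    rw [integral_conj, integral_sub hb (integrable_const d), integral_eval_pi_complexGaussian]
    simp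
  have hd' : Integrable (fun g : Fin n → ℂ => (starRingEnd ℂ) (g b - d))
      (Measure.pi fun _ => complexGaussian) :=
    ((memLp_eval_sub_const b d).star).integrable one_le_two
  have hab : Integrable (fun g : Fin n → ℂ => g a * (starRingEnd ℂ) (g b) -
      g a * (starRingEnd ℂ) d) (Measure.pi fun _ => complexGaussian) :=
    (integrable_eval_mul_conj_eval a b).sub (ha.mul_const _)
  simp_rw [e]
  rw [integral_sub hab
    (hd'.const_mul c), integral_sub (integrable_eval_mul_conj_eval a b) (ha.mul_const _),
    integral_eval_mul_conj_eval, integral_mul_const, integral_eval_pi_complexGaussian,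
    integral_const_mul, hd]
  ring

theorem det_mul_conj_det_eq_sum {n : ℕ} (A : Fin n → Fin n → ℂ) (ζ : ℂ) :
    (Matrix.of A - ζ • 1).det * (starRingEnd ℂ) (Matrix.of A - ζ • 1).det =
      ∑ σ : Equiv.Perm (Fin n), ∑ τ : Equiv.Perm (Fin n),
        (((Equiv.Perm.sign σ : ℤ) : ℂ) * ((Equiv.Perm.sign τ : ℤ) : ℂ)) *
        ∏ i, (A i (σ i) - if i = σ i then ζ else 0) *
          (starRingEnd ℂ) (A i (τ i) - if i = τ i then ζ else 0) := by
  have h : (Matrix.of A - ζ • 1).det = ∑ σ : Equiv.Perm (Fin n),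
      ((Equiv.Perm.sign σ : ℤ) : ℂ) * ∏ i, (A i (σ i) - if i = σ i then ζ else 0) := by
    -- Transposing puts the `i`-th factor of the Leibniz product in row `i`, so that the factors
    -- become independent.
    rw [← Matrix.det_transpose, Matrix.det_apply']
    simp [Matrix.one_apply]
  rw [h, map_sum, Finset.sum_mul_sum]
  refine Finset.sum_congr rfl fun σ _ => Finset.sum_congr rfl fun τ _ => ?_
  rw [Finset.prod_mul_distrib, map_mul, map_prod]
  simp only [map_intCast]
  ring

theorem integrable_det_mul_conj_det {n : ℕ} (ζ : ℂ) :
    Integrable (fun A : Fin n → Fin n → ℂ =>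
      (Matrix.of A - ζ • 1).det * (starRingEnd ℂ) (Matrix.of A - ζ • 1).det)
      (ginibreMeasure n) := by
  simp_rw [det_mul_conj_det_eq_sum]
  refine integrable_finsetSum _ fun σ _ => integrable_finsetSum _ fun τ _ => ?_
  exact (Integrable.fintype_prod_dep fun i => integrable_sub_mul_conj_sub _ _ _ _).const_mul _

/-- Off-diagonal terms vanish. If `σ i ≠ τ i`, the two entries of row `i` are uncorrelated, and at
most one of them has nonzero mean since `i` cannot equal both `σ i` and `τ i`. -/
theorem integral_det_mul_conj_det {n : ℕ} (ζ : ℂ) :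
    ∫ A, (Matrix.of A - ζ • 1).det * (starRingEnd ℂ) (Matrix.of A - ζ • 1).det
      ∂(ginibreMeasure n) =
      ∑ σ : Equiv.Perm (Fin n), ∏ i, (1 + if i = σ i then ((‖ζ‖ ^ 2 : ℝ) : ℂ) else 0) := by
  have hI : ∀ σ τ : Equiv.Perm (Fin n), Integrable (fun A : Fin n → Fin n → ℂ =>
      (((Equiv.Perm.sign σ : ℤ) : ℂ) * ((Equiv.Perm.sign τ : ℤ) : ℂ)) *
        ∏ i, (A i (σ i) - if i = σ i then ζ else 0) *
          (starRingEnd ℂ) (A i (τ i) - if i = τ i then ζ else 0)) (ginibreMeasure n) :=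
    fun σ τ =>
      (Integrable.fintype_prod_dep fun i => integrable_sub_mul_conj_sub _ _ _ _).const_mul _
  simp_rw [det_mul_conj_det_eq_sum]
  rw [integral_finsetSum _ fun σ _ => integrable_finsetSum _ fun τ _ => hI σ τ]
  refine Finset.sum_congr rfl fun σ _ => ?_
  rw [integral_finsetSum _ fun τ _ => hI σ τ, Finset.sum_eq_single σ]
  · rw [integral_const_mul, ← Int.cast_mul, ← Units.val_mul, Int.units_mul_self, Units.val_one,
      Int.cast_one, one_mul, ginibreMeasure, integral_fintype_prod_eq_prod (𝕜 := ℂ)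
      (fun i (g : Fin n → ℂ) => (g (σ i) - if i = σ i then ζ else 0) *
          (starRingEnd ℂ) (g (σ i) - if i = σ i then ζ else 0))]
    refine Finset.prod_congr rfl fun i _ => ?_
    rw [integral_sub_mul_conj_sub, if_pos rfl]
    split_ifs with h
    · rw [Complex.mul_conj, Complex.normSq_eq_norm_sq]
    · simp
  · intro τ _ hτ
    obtain ⟨i, hi⟩ : ∃ i, σ i ≠ τ i := by
      by_contra! h
      exact hτ (Equiv.ext fun i => (h i).symm)
    rw [integral_const_mul, ginibreMeasure, integral_fintype_prod_eq_prod (𝕜 := ℂ)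
      (fun i (g : Fin n → ℂ) => (g (σ i) - if i = σ i then ζ else 0) *
          (starRingEnd ℂ) (g (τ i) - if i = τ i then ζ else 0)),
      Finset.prod_eq_zero (Finset.mem_univ i), mul_zero]
    rw [integral_sub_mul_conj_sub, if_neg hi]
    by_cases h : i = σ i
    · rw [if_neg fun h' : i = τ i => hi (h.symm.trans h')]
      simp
    · simp [h]
  · simp

theorem card_perm_fixing_finset {n : ℕ} (S : Finset (Fin n)) :
    (Finset.univ.filter fun σ : Equiv.Perm (Fin n) => ∀ i ∈ S, i = σ i).card =
      (n - S.card).factorial := by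
  have h := Fintype.card_congr (Equiv.Perm.subtypeEquivSubtypePerm fun i : Fin n => i ∉ S)
  rw [Fintype.card_perm, Fintype.card_subtype_compl, Fintype.card_fin, Fintype.card_coe,
    Fintype.card_subtype] at h
  rw [h]
  congr 1
  ext σ
  simp [eq_comm]

/-- Expand the product over sets `S` of chosen fixed points. A set of size `k` is fixed pointwise by
`(n - k)!` permutations, and there are `n.choose k` such sets. -/
theorem sum_perm_prod_one_add_ite {n : ℕ} (y : ℝ) :
    ∑ σ : Equiv.Perm (Fin n), ∏ i, (1 + if i = σ i then y else 0) =
      ∑ k ∈ Finset.range (n + 1), n.factorial * (y ^ k / k.factorial) := by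
  simp_rw [Finset.prod_one_add]
  rw [Finset.sum_comm]
  have h1 : ∀ S ∈ (Finset.univ : Finset (Fin n)).powerset,
      ∑ σ : Equiv.Perm (Fin n), ∏ i ∈ S, (if i = σ i then y else 0) =
        y ^ S.card * (n - S.card).factorial := by
    intro S _
    rw [← card_perm_fixing_finset S, Finset.card_filter, Nat.cast_sum, Finset.mul_sum]
    refine Finset.sum_congr rfl fun σ _ => ?_
    rw [Finset.prod_ite_zero, Finset.prod_const]
    split_ifs <;> simp
  rw [Finset.sum_congr rfl h1, Finset.sum_powerset_apply_card
    (fun k => y ^ k * ((n - k).factorial : ℝ)), Finset.card_univ, Fintype.card_fin]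
  refine Finset.sum_congr rfl fun k hk => ?_
  have hk : k ≤ n := Nat.lt_succ_iff.1 (Finset.mem_range.1 hk)
  have := Nat.choose_mul_factorial_mul_factorial hk
  rw [nsmul_eq_mul, ← this]
  push_cast
  field_simp

/-- Inside the disk the sum is bounded by the full exponential series. Outside, `‖z‖ ^ (2 k) ≤ ‖z‖ ^
(2 n)` is pulled out of the truncated sum first, which leaves at most `exp n`. -/
theorem sum_mul_norm_sq_pow_div_factorial_le (n : ℕ) (z : ℂ) :
    ∑ k ∈ Finset.range (n + 1), (n * ‖z‖ ^ 2) ^ k / (k.factorial : ℝ) ≤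
      Real.exp (2 * diskPotential z + 1) ^ n := by
  rw [← Real.exp_nat_mul]
  unfold diskPotential
  split_ifs with h
  · refine (Real.sum_le_exp_of_nonneg (by positivity) _).trans (le_of_eq ?_)
    congr 1
    ring
  · have hz : 1 < ‖z‖ := not_le.1 h
    have hz0 : 0 < ‖z‖ := by linarith
    have he : Real.exp (n * (2 * Real.log ‖z‖ + 1)) = (‖z‖ ^ 2) ^ n * Real.exp n := by
      rw [mul_add, Real.exp_add, mul_one, show 2 * Real.log ‖z‖ = Real.log (‖z‖ ^ 2) by simp,
        Real.exp_nat_mul, Real.exp_log (by positivity)]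
    rw [he]
    refine le_trans ?_ (mul_le_mul_of_nonneg_left
      (Real.sum_le_exp_of_nonneg (Nat.cast_nonneg n) (n + 1)) (by positivity))
    rw [Finset.mul_sum]
    refine Finset.sum_le_sum fun k hk => ?_
    have hk : k ≤ n := Nat.lt_succ_iff.1 (Finset.mem_range.1 hk)
    rw [mul_pow, mul_comm, mul_div_assoc]
    gcongr
    nlinarith

theorem lintegral_norm_det_sq_le (n : ℕ) (z : ℂ) :
    ∫⁻ A, ENNReal.ofReal (‖(Matrix.of A - ((√(n : ℝ) : ℂ) * z) • 1).det‖ ^ 2)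
      ∂(ginibreMeasure n) ≤
      ENNReal.ofReal (n.factorial * Real.exp (2 * diskPotential z + 1) ^ n) := by
  set ζ : ℂ := (√(n : ℝ) : ℂ) * z with hζ
  have hn : ‖ζ‖ ^ 2 = n * ‖z‖ ^ 2 := by
    rw [hζ, norm_mul, mul_pow, Complex.norm_real, Real.norm_eq_abs, sq_abs,
      Real.sq_sqrt (by positivity)]
  have e : ∀ A : Fin n → Fin n → ℂ,
      (Matrix.of A - ζ • 1).det * (starRingEnd ℂ) (Matrix.of A - ζ • 1).det =
        ((‖(Matrix.of A - ζ • 1).det‖ ^ 2 : ℝ) : ℂ) := fun A => by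
    rw [Complex.mul_conj, Complex.normSq_eq_norm_sq]
  have hI := integrable_det_mul_conj_det (n := n) ζ
  have hE := integral_det_mul_conj_det (n := n) ζ
  simp_rw [e] at hI hE
  rw [integral_complex_ofReal] at hE
  have hE' : ∫ A, ‖(Matrix.of A - ζ • 1).det‖ ^ 2 ∂(ginibreMeasure n) =
      ∑ σ : Equiv.Perm (Fin n), ∏ i, (1 + if i = σ i then ‖ζ‖ ^ 2 else 0) := by
    apply Complex.ofReal_injective
    rw [hE]
    push_cast
    refine Finset.sum_congr rfl fun σ _ => Finset.prod_congr rfl fun i _ => ?_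
    split_ifs <;> simp
  have hI' : Integrable (fun A : Fin n → Fin n → ℂ => ‖(Matrix.of A - ζ • 1).det‖ ^ 2)
      (ginibreMeasure n) := by
    exact hI.re
  rw [← ofReal_integral_eq_lintegral_ofReal hI' (Eventually.of_forall fun _ => by positivity),
    hE', sum_perm_prod_one_add_ite, ← Finset.mul_sum, hn]
  exact ENNReal.ofReal_le_ofReal (mul_le_mul_of_nonneg_left
    (sum_mul_norm_sq_pow_div_factorial_le n z) (by positivity))

end SecondMoment

/-! ### Concentration of the log-determinant at a fixed point. -/

section LogDet

open scoped ComplexOrder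

/-- The three estimates on `A - √(k + 1) z` that hold with probability `1 - O(1 / k ^ 2)` and
that confine `|det (A - √(k + 1) z)|`. -/
structure IsTypical (k : ℕ) (z : ℂ) (A : Fin (k + 1) → Fin (k + 1) → ℂ) : Prop where
  det_le : ‖(Matrix.of A - ((√(k + 1 : ℝ) : ℂ) * z) • 1).det‖ ^ 2 ≤
    (k + 1 : ℝ) ^ 2 * ((k + 1).factorial * Real.exp (2 * diskPotential z + 1) ^ (k + 1))
  inv_det_shiftedGram_le :
    ‖(shiftedGram A ((√(k + 1 : ℝ) : ℂ) * z) ((k + 1 : ℝ) ^ 6)⁻¹).det‖⁻¹ ≤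
    (k + 1 : ℝ) ^ 2 * (Real.exp (-(2 * diskPotential z + 1)) ^ k /
      (k.factorial * ((k + 1 : ℝ) ^ 6)⁻¹))
  adjugate_le : ∀ i j, ‖(Matrix.of A - ((√(k + 1 : ℝ) : ℂ) * z) • 1).adjugate i j‖ ≤
    (k + 1 : ℝ) ^ 2 * ‖(Matrix.of A - ((√(k + 1 : ℝ) : ℂ) * z) • 1).det‖

theorem measurable_det_shiftedGram {n : ℕ} (ζ : ℂ) (t : ℝ) :
    Measurable fun A : Fin n → Fin n → ℂ => (shiftedGram A ζ t).det := by
  have h : Continuous fun A : Fin n → Fin n → ℂ => (Matrix.of A - ζ • 1) :=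
    Continuous.sub (continuous_id (X := Fin n → Fin n → ℂ)) continuous_const
  have : Continuous fun A : Fin n → Fin n → ℂ => (shiftedGram A ζ t).det :=
    ((h.matrix_conjTranspose.matrix_mul h).add continuous_const).matrix_det
  exact this.measurable

theorem measure_mul_lt_le_inv {α : Type*} [MeasurableSpace α] {μ : Measure α}
    {f : α → ℝ} (hf : Measurable f) {a c : ℝ} (ha : 0 < a) (hc : 0 < c)
    (h : ∫⁻ x, ENNReal.ofReal (f x) ∂μ ≤ ENNReal.ofReal a) :
    μ {x | c * a < f x} ≤ ENNReal.ofReal c⁻¹ := by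
  have h1 : μ {x | c * a < f x} ≤ μ {x | ENNReal.ofReal (c * a) ≤ ENNReal.ofReal (f x)} :=
    measure_mono fun x (hx : c * a < f x) => ENNReal.ofReal_le_ofReal hx.le
  refine h1.trans ((meas_ge_le_lintegral_div hf.ennreal_ofReal.aemeasurable
    (by simpa using by positivity) ENNReal.ofReal_ne_top).trans ?_)
  rw [ENNReal.div_le_iff (by simpa using by positivity) ENNReal.ofReal_ne_top,
    ← ENNReal.ofReal_mul (by positivity), inv_mul_cancel_left₀ hc.ne']
  exact h

theorem ginibreMeasure_not_isTypical_le (k : ℕ) (z : ℂ) :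
    ginibreMeasure (k + 1) {A | ¬ IsTypical k z A} ≤ 3 * ENNReal.ofReal ((k + 1 : ℝ) ^ 2)⁻¹ := by
  set ζ : ℂ := (√(k + 1 : ℝ) : ℂ) * z with hζ
  have hk : (0 : ℝ) < (k + 1 : ℝ) ^ 2 := by positivity
  have h1 := measure_mul_lt_le_inv (μ := ginibreMeasure (k + 1))
    (f := fun A => ‖(Matrix.of A - ζ • 1).det‖ ^ 2)
    ((measurable_matrix_det_sub ζ).norm.pow_const 2)
    (a := (k + 1).factorial * Real.exp (2 * diskPotential z + 1) ^ (k + 1)) (by positivity) hk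
    (by simpa using lintegral_norm_det_sq_le (k + 1) z)
  have h2 := measure_mul_lt_le_inv (μ := ginibreMeasure (k + 1))
    (f := fun A => ‖(shiftedGram A ζ ((k + 1 : ℝ) ^ 6)⁻¹).det‖⁻¹)
    (measurable_det_shiftedGram ζ _).norm.inv (by positivity) hk
    (lintegral_inv_norm_det_shiftedGram_le k z (t := ((k + 1 : ℝ) ^ 6)⁻¹) (by positivity))
  have h3 : ginibreMeasure (k + 1) (⋃ p : Fin (k + 1) × Fin (k + 1),
      {A | (k + 1 : ℝ) ^ 2 * ‖(Matrix.of A - ζ • 1).det‖ <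
        ‖(Matrix.of A - ζ • 1).adjugate p.1 p.2‖}) ≤ ENNReal.ofReal ((k + 1 : ℝ) ^ 2)⁻¹ := by
    refine (measure_iUnion_fintype_le _ _).trans ?_
    -- There are `(k + 1) ^ 2` entries, each failing with probability at most `(k + 1) ^ (-4)`.
    refine (Finset.sum_le_sum fun p _ => ginibreMeasure_det_lt_adjugate_le ζ p.2 p.1 hk).trans ?_
    rw [Finset.sum_const, Finset.card_univ, Fintype.card_prod, Fintype.card_fin, nsmul_eq_mul,
      ← ENNReal.ofReal_natCast, ← ENNReal.ofReal_pow (by positivity),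
      ← ENNReal.ofReal_mul (by positivity)]
    refine ENNReal.ofReal_le_ofReal (le_of_eq ?_)
    push_cast
    field_simp
  have hsub : {A | ¬ IsTypical k z A} ⊆
      ({A | (k + 1 : ℝ) ^ 2 * ((k + 1).factorial * Real.exp (2 * diskPotential z + 1) ^ (k + 1)) <
        ‖(Matrix.of A - ζ • 1).det‖ ^ 2} ∪
      {A | (k + 1 : ℝ) ^ 2 * (Real.exp (-(2 * diskPotential z + 1)) ^ k /
        (k.factorial * ((k + 1 : ℝ) ^ 6)⁻¹)) <
          ‖(shiftedGram A ζ ((k + 1 : ℝ) ^ 6)⁻¹).det‖⁻¹}) ∪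
      ⋃ p : Fin (k + 1) × Fin (k + 1),
        {A | (k + 1 : ℝ) ^ 2 * ‖(Matrix.of A - ζ • 1).det‖ <
          ‖(Matrix.of A - ζ • 1).adjugate p.1 p.2‖} := by
    intro A hA
    by_contra hB
    simp only [Set.mem_union, Set.mem_iUnion, not_or, not_exists] at hB
    exact hA ⟨not_lt.1 hB.1.1, not_lt.1 hB.1.2, fun i j => not_lt.1 (hB.2 (i, j))⟩
  refine (measure_mono hsub).trans ((measure_union_le _ _).trans ?_)
  refine (add_le_add ((measure_union_le _ _).trans (add_le_add h1 h2)) h3).trans (le_of_eq ?_)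
  ring

theorem measurableSet_isTypical (k : ℕ) (z : ℂ) : MeasurableSet {A | IsTypical k z A} := by
  set ζ : ℂ := (√(k + 1 : ℝ) : ℂ) * z with hζ
  have h : {A | IsTypical k z A} =
      ({A | ‖(Matrix.of A - ζ • 1).det‖ ^ 2 ≤ (k + 1 : ℝ) ^ 2 *
        ((k + 1).factorial * Real.exp (2 * diskPotential z + 1) ^ (k + 1))} ∩
      {A | ‖(shiftedGram A ζ ((k + 1 : ℝ) ^ 6)⁻¹).det‖⁻¹ ≤
        (k + 1 : ℝ) ^ 2 * (Real.exp (-(2 * diskPotential z + 1)) ^ k /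
        (k.factorial * ((k + 1 : ℝ) ^ 6)⁻¹))}) ∩
      ⋂ i, ⋂ j, {A | ‖(Matrix.of A - ζ • 1).adjugate i j‖ ≤
        (k + 1 : ℝ) ^ 2 * ‖(Matrix.of A - ζ • 1).det‖} := by
    ext A
    simp only [Set.mem_inter_iff, Set.mem_iInter]
    exact ⟨fun h => ⟨⟨h.1, h.2⟩, h.3⟩, fun h => ⟨h.1.1, h.1.2, h.2⟩⟩
  rw [h]
  refine ((measurableSet_le ((measurable_matrix_det_sub ζ).norm.pow_const 2)
    measurable_const).inter (measurableSet_le (measurable_det_shiftedGram ζ _).norm.inv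
    measurable_const)).inter (MeasurableSet.iInter fun i => MeasurableSet.iInter fun j =>
    measurableSet_le (measurable_matrix_adjugate_sub ζ i j).norm
      ((measurable_matrix_det_sub ζ).norm.const_mul _))

/-- The Stirling sequence is decreasing, so it is bounded by its first term. -/
theorem log_factorial_le {n : ℕ} (hn : n ≠ 0) :
    Real.log n.factorial ≤ n * Real.log n - n + Real.log n + 1 := by
  obtain ⟨m, rfl⟩ := Nat.exists_eq_succ_of_ne_zero hn
  have h1 := Stirling.log_stirlingSeq'_antitone (Nat.zero_le m)
  have h2 := Stirling.log_stirlingSeq_formula (m + 1)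
  have h3 := Stirling.log_stirlingSeq_formula 1
  have hpos : (1 : ℝ) ≤ ((m + 1 : ℕ) : ℝ) := by exact_mod_cast Nat.succ_le_succ (Nat.zero_le m)
  have hlog := Real.log_nonneg hpos
  simp only [Function.comp_apply, Nat.succ_eq_add_one, zero_add] at h1
  rw [h2, h3] at h1
  have e1 : Real.log (((m + 1 : ℕ) : ℝ) / Real.exp 1) = Real.log ((m + 1 : ℕ) : ℝ) - 1 := by
    rw [Real.log_div (by positivity) (by positivity), Real.log_exp]
  have e2 : Real.log (2 * ((m + 1 : ℕ) : ℝ)) = Real.log 2 + Real.log ((m + 1 : ℕ) : ℝ) :=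
    Real.log_mul (by norm_num) (by positivity)
  rw [e1, e2] at h1
  simp only [Nat.factorial_one, Nat.cast_one, Real.log_one, one_div, Real.log_inv,
    Real.log_exp, mul_one] at h1
  rw [Nat.succ_eq_add_one]
  linarith

theorem le_log_factorial (n : ℕ) : n * Real.log n - n ≤ Real.log n.factorial := by
  rcases eq_or_ne n 0 with rfl | hn
  · simp
  · have h := Stirling.le_log_factorial_stirling hn
    have hpos : (1 : ℝ) ≤ n := by exact_mod_cast Nat.one_le_iff_ne_zero.2 hn
    have h2 : 0 ≤ Real.log (2 * Real.pi) := Real.log_nonneg (by linarith [Real.pi_gt_three])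
    linarith [Real.log_nonneg hpos]

/-- The factorials contribute `(k + 1) log (k + 1) - (k + 1)` up to `O(log k)`, which explains the
normalization. In the lower bound the `9` is `2` from Markov's inequality, `6` from `t = (k + 1) ^
(-6)` and `1` from having `k!` in place of `(k + 1)!`. The term `|2 U + 1|` pays for the exponent
`k` in place of `k + 1`. -/
theorem IsTypical.abs_log_norm_det_sub_le {k : ℕ} {z : ℂ} {A : Fin (k + 1) → Fin (k + 1) → ℂ}
    (hA : IsTypical k z A) (hdet : (Matrix.of A - ((√(k + 1 : ℝ) : ℂ) * z) • 1).det ≠ 0) :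
    |Real.log ‖(Matrix.of A - ((√(k + 1 : ℝ) : ℂ) * z) • 1).det‖ / (k + 1) -
      Real.log (k + 1) / 2 - diskPotential z| ≤
      (9 * Real.log (k + 1) + 2 + |2 * diskPotential z + 1|) / (2 * (k + 1)) := by
  obtain ⟨h1, h2, h3⟩ := hA
  set D := ‖(Matrix.of A - ((√(k + 1 : ℝ) : ℂ) * z) • 1).det‖ with hD
  set U := diskPotential z with hU
  have hDpos : 0 < D := norm_pos_iff.2 hdet
  have hk0 : (0 : ℝ) < k + 1 := by positivity
  have hk1 : (1 : ℝ) ≤ k + 1 := by linarith [Nat.cast_nonneg (α := ℝ) k]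
  have hL := Real.log_nonneg hk1
  have hfac1 := log_factorial_le (Nat.succ_ne_zero k)
  have hfac2 := le_log_factorial (k + 1)
  push_cast at hfac1 hfac2
  have hfac3 : Real.log (k + 1).factorial = Real.log (k + 1) + Real.log k.factorial := by
    rw [Nat.factorial_succ, Nat.cast_mul, Real.log_mul (by positivity) (by positivity)]
    push_cast
    rfl
  have hup : 2 * Real.log D ≤ 2 * Real.log (k + 1) + Real.log (k + 1).factorial +
      (k + 1) * (2 * U + 1) := by
    have := Real.log_le_log (by positivity) h1
    rw [Real.log_mul (by positivity) (by positivity), Real.log_mul (by positivity) (by positivity),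
      Real.log_pow, Real.log_pow, Real.log_pow, Real.log_exp] at this
    push_cast at this
    linarith
  have hlow : Real.log k.factorial + k * (2 * U + 1) - 8 * Real.log (k + 1) - 1 ≤
      2 * Real.log D := by
    -- With `n = k + 1` and `R = n²`, the choice `t = n ^ (-6)` gives `t n² R² = 1` exactly.
    have h4 := norm_det_conjTranspose_mul_self_add_le hdet h3
      (t := ((k + 1 : ℝ) ^ 6)⁻¹) (by positivity) (by
        push_cast
        field_simp
        exact le_rfl)
    have hK : 0 < ‖(shiftedGram A ((√(k + 1 : ℝ) : ℂ) * z) ((k + 1 : ℝ) ^ 6)⁻¹).det‖ :=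
      norm_pos_iff.2 (posDef_shiftedGram A _ (by positivity)).det_pos.ne'
    have h5 := Real.log_le_log (inv_pos.2 hK) h2
    have h6 : Real.log ‖(shiftedGram A ((√(k + 1 : ℝ) : ℂ) * z) ((k + 1 : ℝ) ^ 6)⁻¹).det‖ ≤
      Real.log (Real.exp 1 * D ^ 2) := Real.log_le_log hK h4
    rw [Real.log_mul (by positivity) (by positivity), Real.log_exp, Real.log_pow] at h6
    rw [Real.log_inv, Real.log_mul (by positivity) (by positivity), Real.log_pow,
      Real.log_div (by positivity) (by positivity), Real.log_mul (by positivity) (by positivity),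
      Real.log_inv, Real.log_pow, Real.log_pow, Real.log_exp] at h5
    push_cast at h5 h6
    linarith
  have habs := abs_le.1 (le_refl |2 * U + 1|)
  have e : Real.log D / (k + 1) - Real.log (k + 1) / 2 - U =
      (2 * Real.log D - (k + 1) * Real.log (k + 1) - (k + 1) * (2 * U)) / (2 * (k + 1)) := by
    field_simp
  rw [e, abs_div, abs_of_pos (show (0 : ℝ) < 2 * (k + 1) by positivity)]
  gcongr
  rw [abs_le]
  constructor <;> nlinarith

end LogDet

/-! ### Almost sure convergence of the log-determinants. -/

section AlmostSure

variable {Ω : Type*} [MeasurableSpace Ω] {P : Measure Ω} [IsProbabilityMeasure P]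
  {M : (k : ℕ) → Ω → Matrix (Fin (k + 1)) (Fin (k + 1)) ℂ}

/-- First Borel-Cantelli lemma: only summability of the individual failure probabilities is used,
hence only the law of each matrix. -/
theorem ae_eventually_isTypical (hM : ∀ k, IsGinibre P (M k)) (z : ℂ) :
    ∀ᵐ ω ∂P, ∀ᶠ k in atTop, IsTypical k z (fun i j => M k ω i j) := by
  have hP : ∀ k, P {ω | ¬ IsTypical k z (fun i j => M k ω i j)} ≤
      3 * ENNReal.ofReal ((k + 1 : ℝ) ^ 2)⁻¹ := by
    intro k
    have h := Measure.map_apply_of_aemeasurable (hM k).aemeasurable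
      (measurableSet_isTypical k z).compl
    rw [(hM k).map_eq] at h
    exact h.symm.le.trans (ginibreMeasure_not_isTypical_le k z)
  have hsum : ∑' k : ℕ, P {ω | ¬ IsTypical k z (fun i j => M k ω i j)} ≠ ∞ := by
    refine ne_top_of_le_ne_top ?_ (ENNReal.tsum_le_tsum hP)
    rw [ENNReal.tsum_mul_left]
    refine ENNReal.mul_ne_top (by norm_num) ?_
    have hs : Summable fun k : ℕ => ((k + 1 : ℝ) ^ 2)⁻¹ := by
      have := (summable_nat_add_iff 1).2 (Real.summable_nat_pow_inv.2 one_lt_two)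
      simpa using this
    exact hs.tsum_ofReal_ne_top
  filter_upwards [ae_eventually_notMem hsum] with ω hω
  exact hω.mono fun k hk => not_not.1 hk

theorem tendsto_typical_error (c : ℝ) :
    Tendsto (fun k : ℕ => (9 * Real.log (k + 1) + 2 + c) / (2 * (k + 1))) atTop (𝓝 0) := by
  have h1 : Tendsto (fun x : ℝ => (9 * Real.log x + 2 + c) / (2 * x)) atTop (𝓝 0) := by
    have ha : Tendsto (fun x : ℝ => Real.log x / x) atTop (𝓝 0) := by
      simpa using Real.tendsto_pow_log_div_mul_add_atTop 1 0 1 one_ne_zero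
    have hb : Tendsto (fun x : ℝ => (2 + c) / 2 * x⁻¹) atTop (𝓝 0) := by
      simpa using tendsto_inv_atTop_zero.const_mul ((2 + c) / 2)
    have h := (ha.const_mul (9 / 2)).add hb
    rw [mul_zero, add_zero] at h
    refine h.congr fun x => ?_
    simp only [div_eq_mul_inv, mul_inv]
    ring
  exact h1.comp (tendsto_natCast_atTop_atTop.atTop_add tendsto_const_nhds)

theorem measurable_diskPotential : Measurable diskPotential := by
  unfold diskPotential
  exact Measurable.ite (measurableSet_le measurable_norm measurable_const)
    (by fun_prop) (Real.measurable_log.comp measurable_norm)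

theorem ae_det_sub_smul_ne_zero {k : ℕ} (A : Matrix (Fin (k + 1)) (Fin (k + 1)) ℂ) :
    ∀ᵐ z : ℂ, (A - ((√(k + 1 : ℝ) : ℂ) * z) • 1).det ≠ 0 := by
  have hs : (√(k + 1 : ℝ) : ℂ) ≠ 0 := by
    exact_mod_cast (Real.sqrt_pos.2 (by positivity : (0 : ℝ) < k + 1)).ne'
  have hfin : {z : ℂ | (A - ((√(k + 1 : ℝ) : ℂ) * z) • 1).det = 0}.Finite := by
    refine ((A.charpoly.rootSet_finite ℂ).preimage
      (f := fun z => (√(k + 1 : ℝ) : ℂ) * z) (mul_right_injective₀ hs).injOn).subset ?_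
    intro z hz
    have hz : (A - ((√(k + 1 : ℝ) : ℂ) * z) • 1).det = 0 := hz
    rw [Set.mem_preimage, Polynomial.mem_rootSet]
    refine ⟨A.charpoly_monic.ne_zero, ?_⟩
    rw [Polynomial.coe_aeval_eq_eval, Matrix.eval_charpoly, Matrix.scalar_apply,
      ← Matrix.smul_one_eq_diagonal, ← neg_sub, Matrix.det_neg, hz, mul_zero]
  simpa [ae_iff] using hfin.measure_zero volume

/-- Almost surely the normalized log-determinants `log |det (M_k - √(k + 1) z)|` converge to the
logarithmic potential of the uniform distribution on the unit disk for almost every `z`. -/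
theorem ae_ae_tendsto_log_norm_det (hM : ∀ k, IsGinibre P (M k)) :
    ∀ᵐ ω ∂P, ∀ᵐ z : ℂ, Tendsto (fun k : ℕ =>
      Real.log ‖(M k ω - ((√(k + 1 : ℝ) : ℂ) * z) • 1).det‖ / (k + 1) - Real.log (k + 1) / 2)
      atTop (𝓝 (diskPotential z)) := by
  classical
  -- The matrices are only almost everywhere measurable. Measurable versions are needed for joint
  -- measurability in `(ω, z)`, on which the exchange of quantifiers rests.
  set X : (k : ℕ) → Ω → Fin (k + 1) → Fin (k + 1) → ℂ := fun k => (hM k).aemeasurable.mk _ with hX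
  have hXm : ∀ k, Measurable (X k) := fun k => (hM k).aemeasurable.measurable_mk
  have hXM : ∀ᵐ ω ∂P, ∀ k, (fun i j => M k ω i j) = X k ω :=
    ae_all_iff.2 fun k => (hM k).aemeasurable.ae_eq_mk
  set d : (k : ℕ) → Ω × ℂ → ℂ := fun k p =>
    (Matrix.of (X k p.1) - ((√(k + 1 : ℝ) : ℂ) * p.2) • 1).det with hd
  have hdm : ∀ k, Measurable (d k) := by
    intro k
    simp_rw [hd, Matrix.det_apply, Matrix.sub_apply, Matrix.of_apply, Matrix.smul_apply]
    have := hXm k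
    fun_prop
  -- A typical matrix may still be singular at `z`, and the error estimate then says nothing. The
  -- value `0` covers this case; for given `ω` it concerns only countably many `z`.
  set V : (k : ℕ) → Ω × ℂ → ℝ := fun k p =>
    if d k p = 0 then 0 else
      Real.log ‖d k p‖ / (k + 1) - Real.log (k + 1) / 2 - diskPotential p.2 with hV
  have hVm : ∀ k, Measurable (V k) := fun k =>
    Measurable.ite (hdm k (measurableSet_singleton 0)) measurable_const
      ((((Real.measurable_log.comp (hdm k).norm).div_const _).sub_const _).sub
        (measurable_diskPotential.comp measurable_snd))
  have hpt : ∀ z : ℂ, ∀ᵐ ω ∂P, Tendsto (fun k => V k (ω, z)) atTop (𝓝 0) := by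
    intro z
    filter_upwards [ae_eventually_isTypical hM z, hXM] with ω hω hωX
    refine squeeze_zero_norm' ?_ (tendsto_typical_error |2 * diskPotential z + 1|)
    filter_upwards [hω] with k hk
    rw [hωX k] at hk
    rw [Real.norm_eq_abs]
    simp only [hV]
    split_ifs with h0
    · rw [abs_zero]
      have : 0 ≤ Real.log ((k : ℝ) + 1) :=
        Real.log_nonneg (by linarith [Nat.cast_nonneg (α := ℝ) k])
      positivity
    · exact hk.abs_log_norm_det_sub_le h0
  have hms : MeasurableSet {p : Ω × ℂ | Tendsto (fun k => V k p) atTop (𝓝 0)} :=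
    measurableSet_tendsto (𝓝 0) hVm
  have hswap : ∀ᵐ ω ∂P, ∀ᵐ z : ℂ, Tendsto (fun k => V k (ω, z)) atTop (𝓝 0) :=
    (Measure.ae_ae_comm (p := fun ω z => Tendsto (fun k => V k (ω, z)) atTop (𝓝 0)) hms).2
      (Eventually.of_forall hpt)
  filter_upwards [hswap, hXM] with ω hω hωX
  filter_upwards [hω, ae_all_iff.2 fun k => ae_det_sub_smul_ne_zero (M k ω)] with z hz hdet
  rw [← tendsto_sub_nhds_zero_iff]
  refine hz.congr fun k => ?_
  have e : d k (ω, z) = (M k ω - ((√(k + 1 : ℝ) : ℂ) * z) • 1).det := by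
    simp only [hd, ← hωX k]
    rfl
  simp only [hV]
  rw [e, if_neg (hdet k)]

end AlmostSure

/-! ### Elementary bounds on the logarithmic kernel. -/

section LogKernel

/-- The negative part of `log ‖u‖`. -/
noncomputable def logNeg (u : ℂ) : ℝ := max (-Real.log ‖u‖) 0

theorem logNeg_nonneg (u : ℂ) : 0 ≤ logNeg u := le_max_right _ _

theorem neg_log_norm_le_logNeg (u : ℂ) : -Real.log ‖u‖ ≤ logNeg u := le_max_left _ _

theorem measurable_log_norm : Measurable fun u : ℂ => Real.log ‖u‖ :=
  Real.measurable_log.comp measurable_norm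

theorem measurable_logNeg : Measurable logNeg := measurable_log_norm.neg.max measurable_const

theorem logNeg_eq_zero {u : ℂ} (hu : 1 ≤ ‖u‖) : logNeg u = 0 :=
  max_eq_right (neg_nonpos.2 (Real.log_nonneg hu))

theorem logNeg_of_norm_le_one {u : ℂ} (hu : ‖u‖ ≤ 1) : logNeg u = -Real.log ‖u‖ :=
  max_eq_left (neg_nonneg.2 (Real.log_nonpos (norm_nonneg u) hu))

theorem integrable_logNeg : Integrable logNeg := by
  have h : IntegrableOn (fun u : ℂ => -Real.log ‖u‖) (Metric.ball 0 1) := by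
    refine (integrableOn_fun_norm_addHaar (volume : Measure ℂ)
      (f := fun y => -Real.log y)).2 ?_
    rw [Complex.finrank_real_complex]
    have hc : Continuous fun y : ℝ => -(y * Real.log y) := Real.continuous_mul_log.neg
    refine (hc.integrableOn_Icc (a := 0) (b := 1)).mono_set Set.Ioo_subset_Icc_self |>.congr_fun
      (fun y _ => ?_) measurableSet_Ioo
    simp
  have e : logNeg = (Metric.ball (0 : ℂ) 1).indicator fun u => -Real.log ‖u‖ := by
    ext u
    by_cases hu : u ∈ Metric.ball (0 : ℂ) 1
    · rw [Set.indicator_of_mem hu]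
      exact logNeg_of_norm_le_one (mem_ball_zero_iff.1 hu).le
    · rw [Set.indicator_of_notMem hu]
      exact logNeg_eq_zero (not_lt.1 fun h => hu (mem_ball_zero_iff.2 h))
  rw [e]
  exact h.integrable_indicator Metric.isOpen_ball.measurableSet

theorem log_norm_sub_le {z w : ℂ} {R : ℝ} (hz : ‖z‖ ≤ R) :
    Real.log ‖z - w‖ ≤ Real.log (1 + R) + Real.log (1 + ‖w‖) := by
  have hR : 0 ≤ R := (norm_nonneg z).trans hz
  rw [← Real.log_mul (by positivity) (by positivity)]
  rcases eq_or_ne ‖z - w‖ 0 with h | h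
  · rw [h, Real.log_zero]
    exact Real.log_nonneg (by nlinarith [norm_nonneg w, mul_nonneg hR (norm_nonneg w)])
  · refine Real.log_le_log (lt_of_le_of_ne (norm_nonneg _) h.symm) ?_
    nlinarith [norm_sub_le z w, norm_nonneg w, mul_nonneg hR (norm_nonneg w)]

theorem abs_log_norm_sub_le {z w : ℂ} {R : ℝ} (hz : ‖z‖ ≤ R) :
    |Real.log ‖z - w‖| ≤ Real.log (1 + R) + Real.log (1 + ‖w‖) + logNeg (z - w) := by
  have h1 := log_norm_sub_le (w := w) hz
  have h2 := neg_log_norm_le_logNeg (z - w)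
  have h3 := logNeg_nonneg (z - w)
  have h4 : 0 ≤ Real.log (1 + R) := Real.log_nonneg (by linarith [norm_nonneg z])
  have h5 : 0 ≤ Real.log (1 + ‖w‖) := Real.log_nonneg (by linarith [norm_nonneg w])
  rw [abs_le]
  constructor <;> linarith

/-- If `‖z - w‖ ≤ 1` then `1 + ‖w‖ ≤ 3`; otherwise `1 + ‖w‖ ≤ 2 + ‖z - w‖ ≤ 3 ‖z - w‖`. The constant
`4` covers both. -/
theorem log_one_add_norm_sub_le {z w : ℂ} (hz : ‖z‖ ≤ 1) :
    Real.log (1 + ‖w‖) - Real.log 4 - logNeg (z - w) ≤ Real.log ‖z - w‖ := by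
  rcases le_or_gt ‖z - w‖ 1 with h | h
  · rw [logNeg_of_norm_le_one h]
    have : Real.log (1 + ‖w‖) ≤ Real.log 4 := by
      refine Real.log_le_log (by positivity) ?_
      have := norm_sub_norm_le w z
      rw [norm_sub_rev] at this
      linarith
    linarith
  · rw [logNeg_eq_zero h.le, sub_zero, ← Real.log_div (by positivity) (by norm_num)]
    refine Real.log_le_log (by positivity) ?_
    have := norm_sub_norm_le w z
    rw [norm_sub_rev] at this
    linarith

theorem integrableOn_log_norm_sub (w : ℂ) (R : ℝ) :
    IntegrableOn (fun z : ℂ => Real.log ‖z - w‖) (Metric.closedBall 0 R) := by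
  have h : IntegrableOn (fun z : ℂ => Real.log (1 + R) + Real.log (1 + ‖w‖) + logNeg (z - w))
      (Metric.closedBall 0 R) := by
    refine IntegrableOn.add ?_ ?_
    · exact integrableOn_const (isCompact_closedBall _ _).measure_lt_top.ne
    · exact (integrable_logNeg.comp_sub_right w).integrableOn
  refine Integrable.mono' h ?_ ?_
  · exact (measurable_log_norm.comp (measurable_id.sub_const w)).aestronglyMeasurable
  · refine (ae_restrict_iff' Metric.isClosed_closedBall.measurableSet).2
      (Eventually.of_forall fun z hz => ?_)
    exact abs_log_norm_sub_le (mem_closedBall_zero_iff.1 hz)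

end LogKernel

/-! ### The potential of the uniform law on the disk. -/

section DiskPotential

theorem integral_uniformDisk (f : ℂ → ℝ) :
    ∫ w, f w ∂uniformDisk = Real.pi⁻¹ * ∫ w in Metric.closedBall (0 : ℂ) 1, f w := by
  have h : uniformDisk = ENNReal.ofReal (1 / Real.pi) •
      (volume : Measure ℂ).restrict (Metric.closedBall 0 1) := by
    rw [uniformDisk, withDensity_indicator Metric.isClosed_closedBall.measurableSet,
      withDensity_const]
  rw [h, integral_smul_measure, ENNReal.toReal_ofReal (by positivity), one_div, smul_eq_mul]

theorem uniformDisk_compl_closedBall : uniformDisk (Metric.closedBall (0 : ℂ) 1)ᶜ = 0 := by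
  rw [uniformDisk, withDensity_indicator Metric.isClosed_closedBall.measurableSet,
    withDensity_const, Measure.smul_apply, Measure.restrict_apply
      Metric.isClosed_closedBall.measurableSet.compl]
  simp

theorem ae_uniformDisk_norm_le_one : ∀ᵐ ξ ∂uniformDisk, ‖ξ‖ ≤ 1 := by
  rw [ae_iff]
  refine measure_mono_null (fun ξ hξ => ?_) uniformDisk_compl_closedBall
  simpa using hξ

theorem setIntegral_polarCoord_target {f : ℂ → ℝ} (hf : Integrable f) (hfm : Measurable f) :
    ∫ z, f z = ∫ r in Set.Ioi (0 : ℝ), ∫ θ in Set.Ioo (-Real.pi) Real.pi,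
      r * f (Complex.polarCoord.symm (r, θ)) := by
  rw [← Complex.integral_comp_polarCoord_symm]
  have hm : Measurable fun p : ℝ × ℝ => p.1 • f (Complex.polarCoord.symm p) := by
    simp_rw [Complex.polarCoord_symm_apply]
    fun_prop
  refine (setIntegral_prod _ ?_).trans ?_
  · refine ⟨hm.aestronglyMeasurable, ?_⟩
    have h := Complex.lintegral_comp_polarCoord_symm fun z => ‖f z‖ₑ
    rw [HasFiniteIntegral]
    refine lt_of_le_of_lt (le_of_eq ?_) (h.trans_lt hf.2)
    change ∫⁻ p in polarCoord.target, _ = _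
    refine setLIntegral_congr_fun polarCoord.open_target.measurableSet fun p hp => ?_
    have hp1 : 0 < p.1 := hp.1
    simp only [smul_eq_mul]
    rw [enorm_mul, Real.enorm_eq_ofReal hp1.le]
  · simp

/-- The circle average of `log ‖· - z‖`, given by Jensen's formula as `log r` plus the positive part
of `log (‖z‖ / r)`. -/
theorem integral_Ioo_log_norm_polarCoord_sub {r : ℝ} (hr : 0 < r) (z : ℂ) :
    ∫ θ in Set.Ioo (-Real.pi) Real.pi, Real.log ‖z - Complex.polarCoord.symm (r, θ)‖ =
      2 * Real.pi * Real.log (max r ‖z‖) := by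
  have h := circleAverage_log_norm_sub_const_eq_log_radius_add_posLog (a := z) (c := 0) hr.ne'
  have e : ∀ θ : ℝ, Real.log ‖z - Complex.polarCoord.symm (r, θ)‖ =
      Real.log ‖circleMap 0 r θ - z‖ := by
    intro θ
    rw [norm_sub_rev, Complex.polarCoord_symm_apply]
    congr 3
    simp [circleMap, Complex.exp_mul_I]
  have hper : Function.Periodic (fun θ : ℝ => Real.log ‖circleMap 0 r θ - z‖)
      (2 * Real.pi) := fun θ => by
    simp only [periodic_circleMap 0 r θ]
  have hI := hper.intervalIntegral_add_eq (-Real.pi) 0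
  rw [show -Real.pi + 2 * Real.pi = Real.pi by ring, zero_add] at hI
  simp_rw [e]
  rw [← integral_Ioc_eq_integral_Ioo, ← intervalIntegral.integral_of_le
    (by linarith [Real.pi_pos]), hI]
  rw [Real.circleAverage, smul_eq_mul, inv_mul_eq_iff_eq_mul₀ (by positivity)] at h
  rw [h]
  congr 1
  rcases le_or_gt ‖z‖ r with hz | hz
  · rw [max_eq_left hz, Real.posLog_eq_zero_iff .. |>.2, add_zero]
    rw [zero_sub, norm_neg, abs_of_nonneg (by positivity), inv_mul_le_iff₀ hr, mul_one]
    exact hz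
  · have : 1 ≤ |r⁻¹ * ‖0 - z‖| := by
      rw [zero_sub, norm_neg, abs_of_nonneg (by positivity), le_inv_mul_iff₀ hr, mul_one]
      exact hz.le
    rw [max_eq_right hz.le, Real.posLog_eq_log this, zero_sub, norm_neg,
      Real.log_mul (inv_pos.2 hr).ne' (hr.trans hz).ne', Real.log_inv]
    ring

theorem integral_two_mul_log_max (a : ℝ) (ha : 0 ≤ a) :
    ∫ r in (0 : ℝ)..1, 2 * (r * Real.log (max r a)) =
      if a ≤ 1 then (a ^ 2 - 1) / 2 else Real.log a := by
  -- The primitive `r² log r - r² / 2` is written with the factor `r * log r`, which is continuous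
  -- at `0`, so that `b = 0` is allowed.
  have hF : ∀ b c : ℝ, 0 ≤ b → b ≤ c → ∫ r in b..c, 2 * (r * Real.log r) =
      (c * (c * Real.log c) - c ^ 2 / 2) - (b * (b * Real.log b) - b ^ 2 / 2) := by
    intro b c hb hbc
    refine intervalIntegral.integral_eq_sub_of_hasDerivAt_of_le hbc
      (f := fun r => r * (r * Real.log r) - r ^ 2 / 2) ?_ ?_ ?_
    · exact ((continuous_id.mul Real.continuous_mul_log).sub (by fun_prop)).continuousOn
    · intro x hx
      have hx0 : x ≠ 0 := (hb.trans_lt hx.1).ne'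
      have h := ((hasDerivAt_id x).mul ((hasDerivAt_id x).mul (Real.hasDerivAt_log hx0))).sub
        ((hasDerivAt_pow 2 x).div_const 2)
      refine h.congr_deriv ?_
      simp only [id, Nat.cast_ofNat, Pi.mul_apply]
      field_simp
      ring
    · exact (Real.continuous_mul_log.const_mul 2).intervalIntegrable _ _
  split_ifs with h
  · have h1 : ∫ r in (0 : ℝ)..a, 2 * (r * Real.log (max r a)) = a ^ 2 * Real.log a := by
      rw [intervalIntegral.integral_congr (g := fun r => (2 * Real.log a) * r)]
      · rw [intervalIntegral.integral_const_mul, integral_id]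
        ring
      · intro r hr
        rw [Set.uIcc_of_le ha] at hr
        simp only [max_eq_right hr.2]
        ring
    have h2 : ∫ r in a..1, 2 * (r * Real.log (max r a)) =
        ∫ r in a..1, 2 * (r * Real.log r) := by
      refine intervalIntegral.integral_congr fun r hr => ?_
      rw [Set.uIcc_of_le h] at hr
      simp only [max_eq_left hr.1]
    have hi1 : IntervalIntegrable (fun r => 2 * (r * Real.log (max r a))) volume 0 a := by
      refine IntervalIntegrable.congr (f := fun r => (2 * Real.log a) * r) ?_
        ((continuous_id.const_mul _).intervalIntegrable _ _)
      intro r hr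
      rw [Set.uIoc_of_le ha] at hr
      simp only [max_eq_right hr.2]
      ring
    have hi2 : IntervalIntegrable (fun r => 2 * (r * Real.log (max r a))) volume a 1 := by
      refine IntervalIntegrable.congr (f := fun r => 2 * (r * Real.log r)) ?_
        ((Real.continuous_mul_log.const_mul 2).intervalIntegrable _ _)
      intro r hr
      rw [Set.uIoc_of_le h] at hr
      simp only [max_eq_left hr.1.le]
    rw [← intervalIntegral.integral_add_adjacent_intervals hi1 hi2, h1, h2, hF a 1 ha h]
    simp
    ring
  · rw [intervalIntegral.integral_congr (g := fun r => (2 * Real.log a) * r)]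
    · rw [intervalIntegral.integral_const_mul, integral_id]
      ring
    · intro r hr
      rw [Set.uIcc_of_le zero_le_one] at hr
      simp only [max_eq_right (hr.2.trans (not_le.1 h).le)]
      ring

theorem integral_log_norm_sub_uniformDisk (z : ℂ) :
    ∫ w, Real.log ‖z - w‖ ∂uniformDisk = diskPotential z := by
  have hsymm : ∀ w, Real.log ‖z - w‖ = Real.log ‖w - z‖ := fun w => by rw [norm_sub_rev]
  have hmeas : Measurable fun w : ℂ => Real.log ‖z - w‖ :=
    measurable_log_norm.comp (measurable_const.sub measurable_id)
  have hball : MeasurableSet (Metric.closedBall (0 : ℂ) 1) :=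
    Metric.isClosed_closedBall.measurableSet
  rw [integral_uniformDisk, ← integral_indicator hball, setIntegral_polarCoord_target
    ((integrable_indicator_iff hball).2 (by
      simp_rw [hsymm]
      exact integrableOn_log_norm_sub z 1)) (hmeas.indicator hball)]
  have h1 : ∀ r ∈ Set.Ioi (0 : ℝ), ∫ θ in Set.Ioo (-Real.pi) Real.pi,
      r * (Metric.closedBall (0 : ℂ) 1).indicator (fun w => Real.log ‖z - w‖)
        (Complex.polarCoord.symm (r, θ)) =
      (Set.Ioc (0 : ℝ) 1).indicator
        (fun r => Real.pi * (2 * (r * Real.log (max r ‖z‖)))) r := by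
    intro r hr
    have hr : 0 < r := hr
    by_cases h : r ≤ 1
    · have hmem : ∀ θ : ℝ, Complex.polarCoord.symm (r, θ) ∈ Metric.closedBall (0 : ℂ) 1 := by
        intro θ
        rw [mem_closedBall_zero_iff, Complex.norm_polarCoord_symm, abs_of_pos hr]
        exact h
      rw [Set.indicator_of_mem (show r ∈ Set.Ioc (0 : ℝ) 1 from ⟨hr, h⟩)]
      simp_rw [fun θ => Set.indicator_of_mem (hmem θ) (fun w => Real.log ‖z - w‖)]
      rw [integral_const_mul, integral_Ioo_log_norm_polarCoord_sub hr]
      ring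
    · have hmem : ∀ θ : ℝ, Complex.polarCoord.symm (r, θ) ∉ Metric.closedBall (0 : ℂ) 1 := by
        intro θ
        rw [mem_closedBall_zero_iff, Complex.norm_polarCoord_symm, abs_of_pos hr]
        exact h
      rw [Set.indicator_of_notMem (show r ∉ Set.Ioc (0 : ℝ) 1 from fun h' => h h'.2)]
      simp_rw [fun θ => Set.indicator_of_notMem (hmem θ) (fun w => Real.log ‖z - w‖)]
      simp
  rw [setIntegral_congr_fun measurableSet_Ioi h1, setIntegral_indicator measurableSet_Ioc,
    Set.inter_eq_right.2 Set.Ioc_subset_Ioi_self, ← intervalIntegral.integral_of_le zero_le_one,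
    intervalIntegral.integral_const_mul, integral_two_mul_log_max _ (norm_nonneg z),
    inv_mul_cancel_left₀ Real.pi_ne_zero]
  rfl

end DiskPotential

/-! ### Passing to the limit in integrals of logarithmic potentials. -/

section LogPotential

/-- The logarithmic potential `z ↦ ∫ log ‖z - w‖ dμ(w)` of a measure on `ℂ`. -/
noncomputable def logPotential (μ : Measure ℂ) (z : ℂ) : ℝ := ∫ w, Real.log ‖z - w‖ ∂μ

theorem measurable_log_norm_sub :
    Measurable fun p : ℂ × ℂ => Real.log ‖p.1 - p.2‖ :=
  measurable_log_norm.comp (measurable_fst.sub measurable_snd)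

theorem measurable_logNeg_sub : Measurable fun p : ℂ × ℂ => logNeg (p.1 - p.2) :=
  measurable_logNeg.comp (measurable_fst.sub measurable_snd)

/-- The integral of `(logNeg - B)⁺` over the plane. -/
noncomputable def logNegTail (B : ℝ) : ℝ≥0∞ := ∫⁻ u : ℂ, ENNReal.ofReal (logNeg u - B)

theorem logNegTail_lt_top {B : ℝ} (hB : 0 ≤ B) : logNegTail B < ∞ := by
  refine lt_of_le_of_lt ?_ integrable_logNeg.lintegral_lt_top
  exact lintegral_mono fun u => ENNReal.ofReal_le_ofReal (by linarith)

theorem tendsto_logNegTail : Tendsto (fun n : ℕ => logNegTail n) atTop (𝓝 0) := by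
  have h := tendsto_lintegral_of_dominated_convergence (μ := (volume : Measure ℂ))
    (F := fun (n : ℕ) u => ENNReal.ofReal (logNeg u - n)) (f := fun _ => 0)
    (fun u => ENNReal.ofReal (logNeg u))
    (fun n => (measurable_logNeg.sub_const _).ennreal_ofReal)
    (fun n => Eventually.of_forall fun u => ENNReal.ofReal_le_ofReal
      (by linarith [Nat.cast_nonneg (α := ℝ) n]))
    integrable_logNeg.lintegral_lt_top.ne
    (Eventually.of_forall fun u => by
      refine tendsto_const_nhds.congr' ?_
      filter_upwards [eventually_ge_atTop ⌈logNeg u⌉₊] with n hn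
      rw [ENNReal.ofReal_of_nonpos (sub_nonpos.2 (Nat.ceil_le.1 hn))])
  simpa [logNegTail] using h

variable {μ : Measure ℂ} [IsProbabilityMeasure μ]

/-- By Tonelli and translation invariance the value does not depend on the probability measure `μ`.
Every uniform control of the singularity comes from this. -/
theorem lintegral_lintegral_logNeg_sub (B : ℝ) :
    ∫⁻ z : ℂ, ∫⁻ w, ENNReal.ofReal (logNeg (z - w) - B) ∂μ = logNegTail B := by
  rw [lintegral_lintegral_swap ((measurable_logNeg_sub.sub_const B).ennreal_ofReal.aemeasurable)]
  have h : ∀ w : ℂ, ∫⁻ z : ℂ, ENNReal.ofReal (logNeg (z - w) - B) = logNegTail B := fun w =>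
    lintegral_sub_right_eq_self (fun u => ENNReal.ofReal (logNeg u - B)) w
  simp_rw [h]
  simp

theorem measurable_lintegral_logNeg_sub (B : ℝ) :
    Measurable fun z : ℂ => ∫⁻ w, ENNReal.ofReal (logNeg (z - w) - B) ∂μ :=
  (measurable_logNeg_sub.sub_const B).ennreal_ofReal.lintegral_prod_right'

theorem ae_integrable_logNeg_sub : ∀ᵐ z : ℂ, Integrable (fun w => logNeg (z - w)) μ := by
  have h := ae_lt_top (measurable_lintegral_logNeg_sub (μ := μ) 0)
    (by rw [lintegral_lintegral_logNeg_sub]; exact (logNegTail_lt_top le_rfl).ne)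
  filter_upwards [h] with z hz
  refine ⟨(measurable_logNeg.comp (measurable_const.sub measurable_id)).aestronglyMeasurable, ?_⟩
  rw [hasFiniteIntegral_iff_ofReal (Eventually.of_forall fun w => logNeg_nonneg _)]
  simpa using hz

theorem integrable_log_norm_sub (hμ : Integrable (fun w => Real.log (1 + ‖w‖)) μ) {z : ℂ}
    (hz : Integrable (fun w => logNeg (z - w)) μ) :
    Integrable (fun w => Real.log ‖z - w‖) μ := by
  refine Integrable.mono' (((integrable_const (Real.log (1 + ‖z‖))).add hμ).add hz)
    (measurable_log_norm.comp (measurable_const.sub measurable_id)).aestronglyMeasurable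
    (Eventually.of_forall fun w => abs_log_norm_sub_le le_rfl)

theorem logPotential_le (hμ : Integrable (fun w => Real.log (1 + ‖w‖)) μ) {z : ℂ} {R : ℝ}
    (hz : Integrable (fun w => logNeg (z - w)) μ) (hR : ‖z‖ ≤ R) :
    logPotential μ z ≤ Real.log (1 + R) + ∫ w, Real.log (1 + ‖w‖) ∂μ := by
  have h := integral_mono (integrable_log_norm_sub hμ hz)
    ((integrable_const (Real.log (1 + R))).add hμ) fun w => log_norm_sub_le hR
  refine h.trans (le_of_eq ?_)
  rw [integral_add' (integrable_const _) hμ]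
  simp

/-- As `μ` has mass one, `-B - logPotential μ z` is the average of `-B - log ‖z - w‖`, which lies
below the positive part of `logNeg (z - w) - B`. -/
theorem ofReal_neg_sub_logPotential_le (hμ : Integrable (fun w => Real.log (1 + ‖w‖)) μ) {z : ℂ}
    (hz : Integrable (fun w => logNeg (z - w)) μ) (B : ℝ) :
    ENNReal.ofReal (-B - logPotential μ z) ≤
      ∫⁻ w, ENNReal.ofReal (logNeg (z - w) - B) ∂μ := by
  have hi := integrable_log_norm_sub hμ hz
  have hp : Integrable (fun w => max (logNeg (z - w) - B) 0) μ :=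
    (hz.sub (integrable_const B)).pos_part
  have h1 : -B - logPotential μ z ≤ ∫ w, max (logNeg (z - w) - B) 0 ∂μ := by
    have : -B - logPotential μ z = ∫ w, (-B - Real.log ‖z - w‖) ∂μ := by
      rw [integral_sub (integrable_const _) hi, logPotential]
      simp
    rw [this]
    refine integral_mono ((integrable_const _).sub hi) hp fun w => ?_
    exact le_max_of_le_left (by linarith [neg_log_norm_le_logNeg (z - w)])
  refine (ENNReal.ofReal_le_ofReal h1).trans (le_of_eq ?_)
  rw [ofReal_integral_eq_lintegral_ofReal hp (Eventually.of_forall fun w => le_max_right _ _)]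
  refine lintegral_congr fun w => ?_
  rw [ENNReal.ofReal_max, ENNReal.ofReal_zero, max_eq_left zero_le]

theorem lintegral_ofReal_neg_sub_logPotential_le
    (hμ : Integrable (fun w => Real.log (1 + ‖w‖)) μ) (B : ℝ) :
    ∫⁻ z, ENNReal.ofReal (-B - logPotential μ z) ≤ logNegTail B := by
  rw [← lintegral_lintegral_logNeg_sub (μ := μ)]
  refine lintegral_mono_ae ?_
  filter_upwards [ae_integrable_logNeg_sub (μ := μ)] with z hz
  exact ofReal_neg_sub_logPotential_le hμ hz B

/-- If the logarithmic potentials of probability measures are almost everywhere eventually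
bounded, their logarithmic moments are eventually bounded. -/
theorem exists_integral_log_one_add_norm_le {μs : ℕ → Measure ℂ}
    [∀ n, IsProbabilityMeasure (μs n)]
    (hμs : ∀ n, Integrable (fun w => Real.log (1 + ‖w‖)) (μs n)) {L : ℂ → ℝ}
    (hL : ∀ᵐ z : ℂ, Tendsto (fun n => logPotential (μs n) z) atTop (𝓝 (L z))) :
    ∃ C : ℝ, ∀ᶠ n in atTop, ∫ w, Real.log (1 + ‖w‖) ∂(μs n) ≤ C := by
  -- These sets cover almost all of the unit disk, so one of them has positive measure. It provides
  -- one upper bound `k` for all the potentials with `n ≥ k`.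
  set E : ℕ → Set ℂ := fun k => {z | ‖z‖ ≤ 1 ∧ (∀ n ≥ k, logPotential (μs n) z ≤ k) ∧
    ∀ n, Integrable (fun w => logNeg (z - w)) (μs n)} with hE
  obtain ⟨k, hk⟩ : ∃ k, volume (E k) ≠ 0 := by
    by_contra! h
    have h0 : volume (⋃ k, E k) = 0 := measure_iUnion_null h
    have h1 : ∀ᵐ z : ℂ, z ∉ Metric.closedBall (0 : ℂ) 1 := by
      filter_upwards [hL, ae_all_iff.2 fun n => ae_integrable_logNeg_sub (μ := μs n),
        compl_mem_ae_iff.2 h0] with z hz hint hzE hz1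
      apply hzE
      obtain ⟨m, hm⟩ := eventually_atTop.1 (hz.eventually (eventually_le_nhds
        (lt_add_one (L z))))
      refine Set.mem_iUnion.2 ⟨max m ⌈L z + 1⌉₊, mem_closedBall_zero_iff.1 hz1, fun n hn => ?_,
        hint⟩
      refine (hm n ((le_max_left _ _).trans hn)).trans ((Nat.le_ceil _).trans ?_)
      exact_mod_cast le_max_right _ _
    have h2 : volume (Metric.closedBall (0 : ℂ) 1) = 0 := measure_eq_zero_iff_ae_notMem.2 h1
    exact (Metric.measure_closedBall_pos volume (0 : ℂ) one_pos).ne' h2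
  have hfin : volume (E k) ≠ ∞ := by
    refine ne_top_of_le_ne_top (isCompact_closedBall (0 : ℂ) 1).measure_lt_top.ne
      (measure_mono fun z hz => ?_)
    exact mem_closedBall_zero_iff.2 hz.1
  -- The threshold for Markov's inequality: the integrals of `logNeg (z - w)` cannot exceed `a` on
  -- all of `E k`, since their total is `logNegTail 0`. The `+ 1` makes the contradiction strict.
  -- The point `z` found this way may depend on `n`, but the bounds `k` and `a` do not.
  set a : ℝ≥0∞ := (logNegTail 0 + 1) / volume (E k) with ha
  have ht := (logNegTail_lt_top (le_refl (0 : ℝ))).ne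
  have hat : a ≠ ∞ := ENNReal.div_ne_top (ENNReal.add_ne_top.2 ⟨ht, ENNReal.one_ne_top⟩) hk
  have ha0 : a ≠ 0 := (ENNReal.div_pos (by simp) hfin).ne'
  refine ⟨k + Real.log 4 + a.toReal, eventually_atTop.2 ⟨k, fun n hn => ?_⟩⟩
  obtain ⟨z, hzE, hza⟩ : ∃ z ∈ E k, ∫⁻ w, ENNReal.ofReal (logNeg (z - w) - 0) ∂(μs n) ≤ a := by
    by_contra! h
    have h1 : volume (E k) ≤ logNegTail 0 / a := by
      rw [← lintegral_lintegral_logNeg_sub (μ := μs n)]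
      refine le_trans (measure_mono fun z hz => ?_) (meas_ge_le_lintegral_div
        (measurable_lintegral_logNeg_sub (μ := μs n) 0).aemeasurable ha0 hat)
      exact (h z hz).le
    rw [ENNReal.le_div_iff_mul_le (Or.inl ha0) (Or.inl hat), ha,
      ENNReal.mul_div_cancel hk hfin] at h1
    exact absurd h1 (not_le.2 (ENNReal.lt_add_right ht one_ne_zero))
  have hV : ∫ w, logNeg (z - w) ∂(μs n) ≤ a.toReal := by
    rw [integral_eq_lintegral_of_nonneg_ae (Eventually.of_forall fun w => logNeg_nonneg _)
      (hzE.2.2 n).1]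
    refine ENNReal.toReal_mono hat ?_
    simpa using hza
  have hle := integral_mono (((hμs n).sub (integrable_const (Real.log 4))).sub (hzE.2.2 n))
    (integrable_log_norm_sub (hμs n) (hzE.2.2 n)) fun w => log_one_add_norm_sub_le hzE.1
  rw [integral_sub' ((hμs n).sub (integrable_const (Real.log 4))) (hzE.2.2 n),
    integral_sub' (hμs n) (integrable_const _)] at hle
  have hk2 := hzE.2.1 n hn
  rw [logPotential] at hk2
  simp only [integral_const, probReal_univ, one_smul] at hle
  linarith

theorem integrable_mul_log_norm_sub (hμ : Integrable (fun w => Real.log (1 + ‖w‖)) μ)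
    {g : ℂ → ℝ} (hg : Measurable g) {G R : ℝ} (hG : ∀ z, |g z| ≤ G)
    (hR : ∀ z, R < ‖z‖ → g z = 0) :
    Integrable (fun p : ℂ × ℂ => g p.1 * Real.log ‖p.1 - p.2‖) (volume.prod μ) := by
  set K : Set ℂ := Metric.closedBall 0 R with hK
  have hKm : MeasurableSet K := Metric.isClosed_closedBall.measurableSet
  have hKi : Integrable (K.indicator fun _ => (1 : ℝ)) :=
    (integrable_indicator_iff hKm).2
      (integrableOn_const (isCompact_closedBall _ _).measure_lt_top.ne)
  have hneg : Integrable (fun p : ℂ × ℂ => logNeg (p.1 - p.2)) (volume.prod μ) := by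
    refine ⟨measurable_logNeg_sub.aestronglyMeasurable, ?_⟩
    rw [hasFiniteIntegral_iff_ofReal (Eventually.of_forall fun w => logNeg_nonneg _),
      lintegral_prod _ measurable_logNeg_sub.ennreal_ofReal.aemeasurable]
    have h := lintegral_lintegral_logNeg_sub (μ := μ) 0
    simp only [sub_zero] at h
    rw [h]
    exact logNegTail_lt_top le_rfl
  have hdom := ((hKi.mul_prod ((integrable_const (Real.log (1 + R))).add hμ)).add hneg).const_mul G
  refine hdom.mono' ((hg.comp measurable_fst).mul measurable_log_norm_sub).aestronglyMeasurable
    (Eventually.of_forall fun p => ?_)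
  have hG0 : 0 ≤ G := (abs_nonneg _).trans (hG 0)
  by_cases hp : ‖p.1‖ ≤ R
  · have h1 := abs_log_norm_sub_le (w := p.2) hp
    have hpK : p.1 ∈ K := mem_closedBall_zero_iff.2 hp
    rw [Real.norm_eq_abs, abs_mul]
    simp only [Pi.add_apply, Set.indicator_of_mem hpK, one_mul]
    exact mul_le_mul (hG _) h1 (abs_nonneg _) hG0
  · have hpK : p.1 ∉ K := fun h => hp (mem_closedBall_zero_iff.1 h)
    rw [hR _ (not_le.1 hp), zero_mul, norm_zero]
    simp only [Pi.add_apply, Set.indicator_of_notMem hpK, zero_mul, zero_add]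
    exact mul_nonneg hG0 (logNeg_nonneg _)

theorem integrable_mul_logPotential (hμ : Integrable (fun w => Real.log (1 + ‖w‖)) μ)
    {g : ℂ → ℝ} (hg : Measurable g) {G R : ℝ} (hG : ∀ z, |g z| ≤ G)
    (hR : ∀ z, R < ‖z‖ → g z = 0) : Integrable fun z => g z * logPotential μ z := by
  have h := (integrable_mul_log_norm_sub hμ hg hG hR).integral_prod_left
  simpa only [integral_const_mul, logPotential] using h

theorem integral_mul_logPotential (hμ : Integrable (fun w => Real.log (1 + ‖w‖)) μ)
    {g : ℂ → ℝ} (hg : Measurable g) {G R : ℝ} (hG : ∀ z, |g z| ≤ G)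
    (hR : ∀ z, R < ‖z‖ → g z = 0) :
    ∫ z, g z * logPotential μ z = ∫ w, (∫ z, g z * Real.log ‖z - w‖) ∂μ := by
  rw [← integral_integral_swap (integrable_mul_log_norm_sub hμ hg hG hR)]
  simp only [integral_const_mul, logPotential]

theorem measurable_logPotential : Measurable (logPotential μ) :=
  (measurable_log_norm_sub.stronglyMeasurable.integral_prod_right).measurable

theorem abs_integral_mul_logPotential_sub_max_le
    (hμ : Integrable (fun w => Real.log (1 + ‖w‖)) μ) {g : ℂ → ℝ} (hg : Measurable g) {G R : ℝ}
    (hG : ∀ z, |g z| ≤ G) (hR : ∀ z, R < ‖z‖ → g z = 0) {B : ℝ} (hB : 0 ≤ B) :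
    |(∫ z, g z * logPotential μ z) - ∫ z, g z * max (logPotential μ z) (-B)| ≤
      G * (logNegTail B).toReal := by
  have hG0 : 0 ≤ G := (abs_nonneg _).trans (hG 0)
  have hle := lintegral_ofReal_neg_sub_logPotential_le hμ B
  have hnn : 0 ≤ᵐ[volume] fun z => max (-B - logPotential μ z) 0 :=
    Eventually.of_forall fun _ => le_max_right _ _
  have hpos : Integrable (fun z => max (-B - logPotential μ z) 0) := by
    refine ⟨((measurable_const.sub measurable_logPotential).max
      measurable_const).aestronglyMeasurable, ?_⟩
    rw [hasFiniteIntegral_iff_ofReal hnn]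
    simp only [ENNReal.ofReal_max, ENNReal.ofReal_zero, max_eq_left zero_le]
    exact hle.trans_lt (logNegTail_lt_top hB)
  have hmax : ∀ z, max (logPotential μ z) (-B) =
      logPotential μ z + max (-B - logPotential μ z) 0 := by
    intro z
    rw [← max_add_add_left]
    simp [max_comm]
  have hgi : Integrable fun z => g z * max (-B - logPotential μ z) 0 :=
    hpos.bdd_mul hg.aestronglyMeasurable (Eventually.of_forall hG)
  have hint := integrable_mul_logPotential hμ hg hG hR
  simp_rw [hmax, mul_add]
  rw [integral_add hint hgi, sub_add_cancel_left, abs_neg]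
  calc |∫ z, g z * max (-B - logPotential μ z) 0|
      ≤ ∫ z, G * max (-B - logPotential μ z) 0 := by
        rw [← Real.norm_eq_abs]
        refine norm_integral_le_of_norm_le (hpos.const_mul G) (Eventually.of_forall fun z => ?_)
        rw [Real.norm_eq_abs, abs_mul, abs_of_nonneg (le_max_right (-B - logPotential μ z) 0)]
        exact mul_le_mul_of_nonneg_right (hG z) (le_max_right _ _)
    _ ≤ G * (logNegTail B).toReal := by
        rw [integral_const_mul]
        refine mul_le_mul_of_nonneg_left ?_ hG0
        rw [integral_eq_lintegral_of_nonneg_ae hnn hpos.1]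
        refine ENNReal.toReal_mono (logNegTail_lt_top hB).ne ?_
        simp only [ENNReal.ofReal_max, ENNReal.ofReal_zero, max_eq_left zero_le]
        exact hle

/-- Truncated at `-B`, the potentials are bounded on the support of `g`, from above by the uniform
logarithmic moment, and dominated convergence applies. The truncation costs at most `G * logNegTail
B`, uniformly over the measures, and this tends to `0` as `B` grows. -/
theorem tendsto_integral_mul_logPotential {μs : ℕ → Measure ℂ}
    [∀ n, IsProbabilityMeasure (μs n)]
    (hμs : ∀ n, Integrable (fun w => Real.log (1 + ‖w‖)) (μs n))
    (hμ : Integrable (fun w => Real.log (1 + ‖w‖)) μ)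
    (hL : ∀ᵐ z : ℂ, Tendsto (fun n => logPotential (μs n) z) atTop (𝓝 (logPotential μ z)))
    {g : ℂ → ℝ} (hg : Measurable g) {G R : ℝ} (hG : ∀ z, |g z| ≤ G)
    (hR : ∀ z, R < ‖z‖ → g z = 0) :
    Tendsto (fun n => ∫ z, g z * logPotential (μs n) z) atTop
      (𝓝 (∫ z, g z * logPotential μ z)) := by
  have hG0 : 0 ≤ G := (abs_nonneg _).trans (hG 0)
  obtain ⟨C, hC⟩ := exists_integral_log_one_add_norm_le hμs hL
  have htrunc : ∀ B : ℝ, Tendsto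
      (fun n => ∫ z, g z * max (logPotential (μs n) z) (-B)) atTop
      (𝓝 (∫ z, g z * max (logPotential μ z) (-B))) := by
    intro B
    have hKm : MeasurableSet (Metric.closedBall (0 : ℂ) R) :=
      Metric.isClosed_closedBall.measurableSet
    refine tendsto_integral_filter_of_dominated_convergence
      ((Metric.closedBall (0 : ℂ) R).indicator fun _ => G * (|Real.log (1 + R) + C| + |B|)) ?_ ?_
      ((integrable_indicator_iff hKm).2
        (integrableOn_const (isCompact_closedBall _ _).measure_lt_top.ne)) ?_
    · exact Eventually.of_forall fun n =>
        (hg.mul (measurable_logPotential.max measurable_const)).aestronglyMeasurable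
    · filter_upwards [hC] with n hn
      filter_upwards [ae_integrable_logNeg_sub (μ := μs n)] with z hz
      by_cases hzR : ‖z‖ ≤ R
      · rw [Set.indicator_of_mem (mem_closedBall_zero_iff.2 hzR), Real.norm_eq_abs, abs_mul]
        have h1 := logPotential_le (hμs n) hz hzR
        refine mul_le_mul (hG z) ?_ (abs_nonneg _) hG0
        rw [abs_le]
        constructor
        · have := le_max_right (logPotential (μs n) z) (-B)
          linarith [le_abs_self B, abs_nonneg (Real.log (1 + R) + C)]
        · refine max_le ?_ ?_
          · linarith [le_abs_self (Real.log (1 + R) + C), abs_nonneg B]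
          · linarith [neg_le_abs B, abs_nonneg (Real.log (1 + R) + C)]
      · rw [Set.indicator_of_notMem fun h => hzR (mem_closedBall_zero_iff.1 h),
          hR z (not_le.1 hzR), zero_mul, norm_zero]
    · filter_upwards [hL] with z hz
      exact (hz.max tendsto_const_nhds).const_mul _
  rw [Metric.tendsto_atTop']
  intro ε hε
  have htail : Tendsto (fun n : ℕ => G * (logNegTail n).toReal) atTop (𝓝 0) := by
    have := (ENNReal.tendsto_toReal ENNReal.zero_ne_top).comp tendsto_logNegTail
    simpa using this.const_mul G
  obtain ⟨b, hb⟩ := (htail.eventually (eventually_lt_nhds (show (0 : ℝ) < ε / 3 by positivity))).exists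
  have hb0 : (0 : ℝ) ≤ (b : ℝ) := Nat.cast_nonneg b
  obtain ⟨N, hN⟩ := (Metric.tendsto_atTop'.1 (htrunc b)) (ε / 3) (by positivity)
  refine ⟨N, fun n hn => ?_⟩
  have h1 := abs_integral_mul_logPotential_sub_max_le (hμs n) hg hG hR hb0
  have h2 := abs_integral_mul_logPotential_sub_max_le hμ hg hG hR hb0
  have h3 := hN n hn
  rw [Real.dist_eq, abs_lt] at h3 ⊢
  rw [abs_le] at h1 h2
  constructor <;> linarith

end LogPotential

/-! ### Disk averages and the kernel they produce. -/

section DiskAverage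

theorem uniformDisk_singleton (z : ℂ) : uniformDisk {z} = 0 :=
  withDensity_absolutelyContinuous _ _ (measure_singleton z)

/-- The average of `f` over the disk of radius `r` and centre `z`. -/
noncomputable def diskAverage (f : ℂ → ℝ) (r : ℝ) (z : ℂ) : ℝ := ∫ ξ, f (z + r * ξ) ∂uniformDisk

/-- The difference of the logarithmic potentials of a point mass at the origin and of the uniform
distribution on the disk of radius `r` around it. -/
noncomputable def diskKernel (r : ℝ) (u : ℂ) : ℝ :=
  Real.log ‖u‖ - Real.log r - diskPotential (u / r)

theorem norm_div_ofReal {r : ℝ} (hr : 0 < r) (u : ℂ) : ‖u / (r : ℂ)‖ = ‖u‖ / r := by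
  rw [norm_div, Complex.norm_real, Real.norm_eq_abs, abs_of_pos hr]

theorem diskKernel_of_norm_le {r : ℝ} (hr : 0 < r) {u : ℂ} (hu : ‖u‖ ≤ r) :
    diskKernel r u = Real.log ‖u‖ - Real.log r - ((‖u‖ / r) ^ 2 - 1) / 2 := by
  rw [diskKernel, diskPotential, norm_div_ofReal hr, if_pos ((div_le_one hr).2 hu)]

theorem diskKernel_of_lt_norm {r : ℝ} (hr : 0 < r) {u : ℂ} (hu : r < ‖u‖) :
    diskKernel r u = 0 := by
  have h : ¬ ‖u‖ / r ≤ 1 := by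
    rw [div_le_one hr]
    exact not_le.2 hu
  rw [diskKernel, diskPotential, norm_div_ofReal hr, if_neg h,
    Real.log_div (hr.trans hu).ne' hr.ne']
  ring

/-- This is `log x ≤ x - 1` at `x = (‖u‖ / r) ^ 2`. The origin is excluded because `Real.log 0 = 0`
gives the kernel the value `1 / 2 - log r` there. -/
theorem diskKernel_nonpos {r : ℝ} (hr : 0 < r) {u : ℂ} (hu : u ≠ 0) : diskKernel r u ≤ 0 := by
  rcases le_or_gt ‖u‖ r with h | h
  · have hu' : 0 < ‖u‖ := norm_pos_iff.2 hu
    rw [diskKernel_of_norm_le hr h, ← Real.log_div hu'.ne' hr.ne']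
    have := Real.log_le_sub_one_of_pos (show 0 < (‖u‖ / r) ^ 2 by positivity)
    rw [Real.log_pow] at this
    push_cast at this
    linarith
  · exact (diskKernel_of_lt_norm hr h).le

theorem diskKernel_neg {r : ℝ} (hr : 0 < r) {u : ℂ} (hu : u ≠ 0) (hur : ‖u‖ < r) :
    diskKernel r u < 0 := by
  have hu' : 0 < ‖u‖ := norm_pos_iff.2 hu
  rw [diskKernel_of_norm_le hr hur.le, ← Real.log_div hu'.ne' hr.ne']
  have h1 : ‖u‖ / r < 1 := (div_lt_one hr).2 hur
  have h0 : 0 < ‖u‖ / r := by positivity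
  have := Real.log_lt_sub_one_of_pos (show 0 < (‖u‖ / r) ^ 2 by positivity)
    (by nlinarith)
  rw [Real.log_pow] at this
  push_cast at this
  linarith

theorem integrable_diskKernel {r : ℝ} (hr : 0 < r) : Integrable (diskKernel r) := by
  have hKm : MeasurableSet (Metric.closedBall (0 : ℂ) r) :=
    Metric.isClosed_closedBall.measurableSet
  have e : diskKernel r = (Metric.closedBall (0 : ℂ) r).indicator
      fun u => Real.log ‖u - 0‖ - (Real.log r + ((‖u‖ / r) ^ 2 - 1) / 2) := by
    ext u
    by_cases hu : u ∈ Metric.closedBall (0 : ℂ) r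
    · rw [Set.indicator_of_mem hu, diskKernel_of_norm_le hr (mem_closedBall_zero_iff.1 hu),
        sub_zero]
      ring
    · rw [Set.indicator_of_notMem hu]
      exact diskKernel_of_lt_norm hr (not_le.1 fun h => hu (mem_closedBall_zero_iff.2 h))
  rw [e, integrable_indicator_iff hKm]
  refine (integrableOn_log_norm_sub 0 r).sub
    (ContinuousOn.integrableOn_compact (isCompact_closedBall _ _) (Continuous.continuousOn ?_))
  fun_prop

theorem ae_diskKernel_nonpos {r : ℝ} (hr : 0 < r) : ∀ᵐ u : ℂ, diskKernel r u ≤ 0 := by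
  have : ∀ᵐ u : ℂ, u ≠ 0 := by simp [ae_iff]
  exact this.mono fun u hu => diskKernel_nonpos hr hu

theorem integral_diskKernel_neg {r : ℝ} (hr : 0 < r) : ∫ u, diskKernel r u < 0 := by
  have h : 0 < ∫ u, -diskKernel r u := by
    refine (integral_pos_iff_support_of_nonneg_ae
      ((ae_diskKernel_nonpos hr).mono fun u hu => neg_nonneg.2 hu)
      (integrable_diskKernel hr).neg).2 ?_
    have hsub : Metric.ball (0 : ℂ) r \ {0} ⊆ Function.support fun u => -diskKernel r u :=
      fun u hu => neg_ne_zero.2 (diskKernel_neg hr hu.2 (mem_ball_zero_iff.1 hu.1)).ne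
    refine lt_of_lt_of_le ?_ (measure_mono hsub)
    rw [measure_sdiff_null (measure_singleton _)]
    exact Metric.measure_ball_pos _ _ hr
  rw [integral_neg] at h
  linarith

theorem integral_log_norm_sub_mul_uniformDisk {r : ℝ} (hr : 0 < r) (y : ℂ) :
    ∫ ξ, Real.log ‖y - r * ξ‖ ∂uniformDisk = Real.log r + diskPotential (y / r) := by
  have hr' : (r : ℂ) ≠ 0 := by exact_mod_cast hr.ne'
  have hint : Integrable (fun ξ => Real.log ‖y / r - ξ‖) uniformDisk := by
    have h1 : uniformDisk = ENNReal.ofReal (1 / Real.pi) •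
        (volume : Measure ℂ).restrict (Metric.closedBall 0 1) := by
      rw [uniformDisk, withDensity_indicator Metric.isClosed_closedBall.measurableSet,
        withDensity_const]
    rw [h1]
    refine Integrable.smul_measure ?_ ENNReal.ofReal_ne_top
    simp_rw [norm_sub_rev (y / r)]
    exact integrableOn_log_norm_sub (y / r) 1
  have hae : ∀ᵐ ξ ∂uniformDisk, ξ ≠ y / r := by
    rw [ae_iff]
    simpa using uniformDisk_singleton (y / r)
  have e : (fun ξ : ℂ => Real.log ‖y - r * ξ‖) =ᵐ[uniformDisk]
      fun ξ => Real.log r + Real.log ‖y / r - ξ‖ := by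
    filter_upwards [hae] with ξ hξ
    have h2 : ‖y / (r : ℂ) - ξ‖ ≠ 0 := norm_ne_zero_iff.2 (sub_ne_zero.2 hξ.symm)
    rw [← Real.log_mul hr.ne' h2]
    congr 1
    rw [show y - r * ξ = r * (y / r - ξ) by field_simp, norm_mul, Complex.norm_real,
      Real.norm_eq_abs, abs_of_pos hr]
  rw [integral_congr_ae e, integral_add (integrable_const _) hint,
    integral_log_norm_sub_uniformDisk]
  simp

theorem integrable_log_one_add_norm_of_ae_le {μ : Measure ℂ} [IsProbabilityMeasure μ] {R : ℝ}
    (h : ∀ᵐ w ∂μ, ‖w‖ ≤ R) : Integrable (fun w => Real.log (1 + ‖w‖)) μ := by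
  refine Integrable.of_bound (C := Real.log (1 + R))
    (Real.measurable_log.comp (measurable_const.add measurable_norm)).aestronglyMeasurable
    (h.mono fun w hw => ?_)
  rw [Real.norm_eq_abs, abs_of_nonneg (Real.log_nonneg (by linarith [norm_nonneg w]))]
  exact Real.log_le_log (by positivity) (by linarith)

variable {f : ℂ → ℝ} {G R r : ℝ}

theorem integrable_mul_log_norm_sub_sub_mul (hf : Measurable f) (hG : ∀ z, |f z| ≤ G)
    (hR : ∀ z, R < ‖z‖ → f z = 0) (r : ℝ) (w : ℂ) :
    Integrable (fun p : ℂ × ℂ => f p.1 * Real.log ‖p.1 - w - r * p.2‖)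
      (volume.prod uniformDisk) := by
  -- The uniform law on the disk of radius `|r|` around `w` is an image of `uniformDisk` with
  -- bounded support, so the general integrability result applies to it.
  set T : ℂ → ℂ := fun ξ => w + r * ξ with hT
  have hTm : Measurable T := by fun_prop
  have hmp : MeasurePreserving T uniformDisk (uniformDisk.map T) := ⟨hTm, rfl⟩
  have : IsProbabilityMeasure (uniformDisk.map T) :=
    Measure.isProbabilityMeasure_map hTm.aemeasurable
  have hlog : Integrable (fun w => Real.log (1 + ‖w‖)) (uniformDisk.map T) := by
    refine integrable_log_one_add_norm_of_ae_le (R := ‖w‖ + |r|) ?_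
    rw [ae_map_iff hTm.aemeasurable (measurableSet_le measurable_norm measurable_const)]
    filter_upwards [ae_uniformDisk_norm_le_one] with ξ hξ
    refine (norm_add_le _ _).trans ?_
    rw [norm_mul, Complex.norm_real, Real.norm_eq_abs]
    nlinarith [abs_nonneg r]
  have h := (((MeasurePreserving.id volume).prod hmp).integrable_comp
    (integrable_mul_log_norm_sub hlog hf hG hR).aestronglyMeasurable).2
    (integrable_mul_log_norm_sub hlog hf hG hR)
  refine h.congr (Eventually.of_forall fun p => ?_)
  simp only [Function.comp_apply, Prod.map, id, hT]
  rw [sub_sub]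

theorem integrable_translate_mul_log_norm_sub (hf : Measurable f) (hG : ∀ z, |f z| ≤ G)
    (hR : ∀ z, R < ‖z‖ → f z = 0) (hr : 0 < r) (w : ℂ) :
    Integrable (fun p : ℂ × ℂ => f (p.1 + r * p.2) * Real.log ‖p.1 - w‖)
      (volume.prod uniformDisk) := by
  have hKm : MeasurableSet (Metric.closedBall (0 : ℂ) (R + r)) :=
    Metric.isClosed_closedBall.measurableSet
  have hG0 : 0 ≤ G := (abs_nonneg _).trans (hG 0)
  have h1 : Integrable ((Metric.closedBall (0 : ℂ) (R + r)).indicator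
      fun z => |Real.log ‖z - w‖|) :=
    (integrable_indicator_iff hKm).2 (integrableOn_log_norm_sub w (R + r)).abs
  have h2 := (h1.mul_prod (integrable_const (μ := uniformDisk) (1 : ℝ))).const_mul G
  have hξ : ∀ᵐ p : ℂ × ℂ ∂(volume.prod uniformDisk), ‖p.2‖ ≤ 1 :=
    Measure.quasiMeasurePreserving_snd.ae ae_uniformDisk_norm_le_one
  refine h2.mono' ?_ (hξ.mono fun p hp => ?_)
  · exact ((hf.comp (by fun_prop)).mul
      (measurable_log_norm.comp (measurable_fst.sub_const w))).aestronglyMeasurable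
  · rw [Real.norm_eq_abs, abs_mul, mul_one]
    by_cases hpK : ‖p.1‖ ≤ R + r
    · rw [Set.indicator_of_mem (mem_closedBall_zero_iff.2 hpK)]
      exact mul_le_mul_of_nonneg_right (hG _) (abs_nonneg _)
    · have h3 : R < ‖p.1 + r * p.2‖ := by
        have h4 := norm_sub_norm_le p.1 (-(r * p.2))
        rw [sub_neg_eq_add, norm_neg, norm_mul, Complex.norm_real, Real.norm_eq_abs,
          abs_of_pos hr] at h4
        nlinarith [not_le.1 hpK]
      rw [hR _ h3, abs_zero, zero_mul]
      exact mul_nonneg hG0 (Set.indicator_nonneg (fun _ _ => abs_nonneg _) _)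

/-- By Fubini and translation the averaging moves from `f` to the logarithm, whose disk averages are
known from the disk potential. -/
theorem integral_diskAverage_mul_log_norm_sub (hf : Measurable f) (hG : ∀ z, |f z| ≤ G)
    (hR : ∀ z, R < ‖z‖ → f z = 0) (hr : 0 < r) (w : ℂ) :
    ∫ z, diskAverage f r z * Real.log ‖z - w‖ =
      ∫ y, f y * (Real.log r + diskPotential ((y - w) / r)) := by
  have h1 := integral_integral_swap
    (f := fun z ξ : ℂ => f (z + r * ξ) * Real.log ‖z - w‖)
    (integrable_translate_mul_log_norm_sub hf hG hR hr w)
  have h2 := integral_integral_swap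
    (f := fun y ξ : ℂ => f y * Real.log ‖y - w - r * ξ‖)
    (integrable_mul_log_norm_sub_sub_mul hf hG hR r w)
  simp only [integral_mul_const, integral_const_mul] at h1 h2
  simp only [diskAverage]
  rw [h1]
  simp_rw [integral_log_norm_sub_mul_uniformDisk hr] at h2
  rw [h2]
  refine integral_congr_ae (Eventually.of_forall fun ξ => ?_)
  have h3 := integral_sub_right_eq_self (μ := (volume : Measure ℂ))
    (fun z => f (z + r * ξ) * Real.log ‖z - w‖) (r * ξ)
  simp only [sub_add_cancel] at h3
  simp only
  rw [← h3]
  refine integral_congr_ae (Eventually.of_forall fun y => ?_)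
  simp only
  rw [sub_right_comm]

/-- Outside the disk of radius `r` the logarithm equals its own disk average, so the difference is
the compactly supported `diskKernel r`. -/
theorem integral_sub_diskAverage_mul_log_norm_sub (hf : Measurable f) (hG : ∀ z, |f z| ≤ G)
    (hR : ∀ z, R < ‖z‖ → f z = 0) (hr : 0 < r) (w : ℂ) :
    ∫ z, (f z - diskAverage f r z) * Real.log ‖z - w‖ = ∫ u, f (u + w) * diskKernel r u := by
  have h1 := (integrable_translate_mul_log_norm_sub hf hG hR hr w).integral_prod_left
  have h2 := (integrable_mul_log_norm_sub_sub_mul hf hG hR r w).integral_prod_left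
  simp only [integral_mul_const, integral_const_mul] at h1 h2
  simp_rw [integral_log_norm_sub_mul_uniformDisk hr] at h2
  have h3 : Integrable fun z => f z * Real.log ‖z - w‖ := by
    -- The single translate `log ‖z - w‖` is the potential of the point mass at `w`.
    have h := (integrable_mul_log_norm_sub (μ := Measure.dirac w)
      (integrable_log_one_add_norm_of_ae_le (R := ‖w‖) (by simp)) hf hG hR).integral_prod_left
    simpa using h
  change Integrable fun z => diskAverage f r z * Real.log ‖z - w‖ at h1
  simp_rw [sub_mul]
  rw [integral_sub h3 h1]
  have h4 := integral_diskAverage_mul_log_norm_sub hf hG hR hr w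
  rw [h4, ← integral_sub h3 h2, ← integral_add_right_eq_self (μ := (volume : Measure ℂ)) _ w]
  refine integral_congr_ae (Eventually.of_forall fun u => ?_)
  simp only [add_sub_cancel_right, diskKernel]
  ring

end DiskAverage

/-! ### From convergence of potentials to weak convergence. -/

section WeakConvergence

variable {f : ℂ → ℝ} {G R r : ℝ}

theorem measurable_diskAverage (hf : Measurable f) (r : ℝ) : Measurable (diskAverage f r) := by
  have h : Measurable fun p : ℂ × ℂ => f (p.1 + r * p.2) := hf.comp (by fun_prop)
  exact (h.stronglyMeasurable.integral_prod_right).measurable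

theorem abs_diskAverage_le (hG : ∀ z, |f z| ≤ G) (r : ℝ) (z : ℂ) : |diskAverage f r z| ≤ G := by
  have h := norm_integral_le_of_norm_le_const (μ := uniformDisk) (f := fun ξ : ℂ => f (z + r * ξ))
    (C := G) (Eventually.of_forall fun ξ => hG _)
  simpa [diskAverage] using h

theorem diskAverage_eq_zero (hR : ∀ z, R < ‖z‖ → f z = 0) (hr : 0 < r) {z : ℂ}
    (hz : R + r < ‖z‖) : diskAverage f r z = 0 := by
  refine integral_eq_zero_of_ae ?_
  filter_upwards [ae_uniformDisk_norm_le_one] with ξ hξ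
  refine hR _ ?_
  have h4 := norm_sub_norm_le z (-(r * ξ))
  rw [sub_neg_eq_add, norm_neg, norm_mul, Complex.norm_real, Real.norm_eq_abs,
    abs_of_pos hr] at h4
  nlinarith

/-- The average of `f` around `w` with respect to the probability density proportional to
`diskKernel r`. -/
noncomputable def diskSmoothing (f : ℂ → ℝ) (r : ℝ) (w : ℂ) : ℝ :=
  (∫ u, f (u + w) * diskKernel r u) / ∫ u, diskKernel r u

theorem integrable_mul_diskKernel (hf : Measurable f) (hG : ∀ z, |f z| ≤ G) (hr : 0 < r) (w : ℂ) :
    Integrable fun u => f (u + w) * diskKernel r u :=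
  (integrable_diskKernel hr).bdd_mul (hf.comp (measurable_add_const w)).aestronglyMeasurable
    (Eventually.of_forall fun _ => hG _)

/-- Because `diskKernel r` is almost everywhere nonpositive with negative integral, division by that
integral gives a probability density, supported where `‖u‖ ≤ r`. -/
theorem abs_diskSmoothing_sub_le (hf : Measurable f) (hG : ∀ z, |f z| ≤ G) (hr : 0 < r) {η : ℝ}
    (w : ℂ) (hη : ∀ u, ‖u‖ ≤ r → |f (u + w) - f w| ≤ η) : |diskSmoothing f r w - f w| ≤ η := by
  have hc := integral_diskKernel_neg hr
  have hi := integrable_mul_diskKernel hf hG hr w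
  have e : diskSmoothing f r w - f w =
      (∫ u, (f (u + w) - f w) * diskKernel r u) / ∫ u, diskKernel r u := by
    simp_rw [sub_mul]
    rw [integral_sub hi ((integrable_diskKernel hr).const_mul _), integral_const_mul,
      diskSmoothing, sub_div, mul_div_cancel_right₀ _ hc.ne]
  rw [e, abs_div, div_le_iff₀ (abs_pos.2 hc.ne), abs_of_neg hc, ← integral_neg,
    ← integral_const_mul, ← Real.norm_eq_abs]
  refine norm_integral_le_of_norm_le ((integrable_diskKernel hr).neg.const_mul η) ?_
  filter_upwards [ae_diskKernel_nonpos hr] with u hu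
  rw [Real.norm_eq_abs, abs_mul, abs_of_nonpos hu]
  rcases le_or_gt ‖u‖ r with h | h
  · exact mul_le_mul_of_nonneg_right (hη u h) (neg_nonneg.2 hu)
  · simp [diskKernel_of_lt_norm hr h]

variable {μ : Measure ℂ} [IsProbabilityMeasure μ]

/-- This expresses the integral of a smoothed test function through the potential alone, by one more
use of Fubini. -/
theorem integrable_diskSmoothing_and_integral_eq
    (hμ : Integrable (fun w => Real.log (1 + ‖w‖)) μ) (hf : Measurable f) (hG : ∀ z, |f z| ≤ G)
    (hR : ∀ z, R < ‖z‖ → f z = 0) (hr : 0 < r) :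
    Integrable (diskSmoothing f r) μ ∧ ∫ w, diskSmoothing f r w ∂μ =
      (∫ z, (f z - diskAverage f r z) * logPotential μ z) / ∫ u, diskKernel r u := by
  have hg : Measurable fun z => f z - diskAverage f r z := hf.sub (measurable_diskAverage hf r)
  have hgG : ∀ z, |f z - diskAverage f r z| ≤ G + G := fun z =>
    (abs_sub _ _).trans (add_le_add (hG z) (abs_diskAverage_le hG r z))
  have hgR : ∀ z, R + r < ‖z‖ → f z - diskAverage f r z = 0 := fun z hz => by
    rw [hR z (by linarith), diskAverage_eq_zero hR hr hz, sub_zero]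
  have h1 := (integrable_mul_log_norm_sub hμ hg hgG hgR).integral_prod_right
  have h2 := integral_mul_logPotential hμ hg hgG hgR
  simp only [integral_sub_diskAverage_mul_log_norm_sub hf hG hR hr] at h1 h2
  refine ⟨h1.div_const _, ?_⟩
  rw [h2, ← integral_div]
  rfl

/-- Uniform continuity gives a radius for which the smoothing is within `ε / 3` of `f` everywhere,
hence under every probability measure. At this fixed radius the smoothed integrals converge. -/
theorem tendsto_integral_of_hasCompactSupport {μs : ℕ → Measure ℂ}
    [∀ n, IsProbabilityMeasure (μs n)]
    (hμs : ∀ n, Integrable (fun w => Real.log (1 + ‖w‖)) (μs n))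
    (hμ : Integrable (fun w => Real.log (1 + ‖w‖)) μ)
    (hL : ∀ᵐ z : ℂ, Tendsto (fun n => logPotential (μs n) z) atTop (𝓝 (logPotential μ z)))
    (hf : Continuous f) (hfc : HasCompactSupport f) :
    Tendsto (fun n => ∫ w, f w ∂(μs n)) atTop (𝓝 (∫ w, f w ∂μ)) := by
  obtain ⟨G, hG⟩ := hfc.exists_bound_of_continuous hf
  obtain ⟨R, hR⟩ : ∃ R : ℝ, ∀ z, R < ‖z‖ → f z = 0 := by
    obtain ⟨R, hR⟩ := hfc.isBounded.subset_closedBall (0 : ℂ)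
    refine ⟨R, fun z hz => by_contra fun h => ?_⟩
    exact not_le.2 hz (mem_closedBall_zero_iff.1 (hR (subset_tsupport _ h)))
  have hfi : ∀ (ν : Measure ℂ) [IsProbabilityMeasure ν], Integrable f ν := fun ν _ =>
    hf.integrable_of_hasCompactSupport hfc
  rw [Metric.tendsto_atTop']
  intro ε hε
  obtain ⟨δ, hδ, hfδ⟩ := Metric.uniformContinuous_iff.1
    (hfc.uniformContinuous_of_continuous hf) (ε / 3) (by positivity)
  have hr : 0 < δ / 2 := by positivity
  have hη : ∀ w u : ℂ, ‖u‖ ≤ δ / 2 → |f (u + w) - f w| ≤ ε / 3 := fun w u hu => by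
    rw [← Real.dist_eq]
    refine (hfδ ?_).le
    rw [dist_eq_norm, add_sub_cancel_right]
    linarith
  have hg : Measurable fun z => f z - diskAverage f (δ / 2) z :=
    hf.measurable.sub (measurable_diskAverage hf.measurable _)
  have hclose : ∀ (ν : Measure ℂ) [IsProbabilityMeasure ν],
      Integrable (fun w => Real.log (1 + ‖w‖)) ν →
      |∫ w, diskSmoothing f (δ / 2) w ∂ν - ∫ w, f w ∂ν| ≤ ε / 3 := by
    intro ν _ hν
    rw [← integral_sub
      (integrable_diskSmoothing_and_integral_eq hν hf.measurable hG hR hr).1 (hfi ν)]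
    have h := norm_integral_le_of_norm_le_const (μ := ν)
      (f := fun w => diskSmoothing f (δ / 2) w - f w) (C := ε / 3)
      (Eventually.of_forall fun w => abs_diskSmoothing_sub_le hf.measurable hG hr w (hη w))
    simpa using h
  have hlim := (tendsto_integral_mul_logPotential hμs hμ hL hg (G := G + G) (R := R + δ / 2)
    (fun z => (abs_sub _ _).trans (add_le_add (hG z) (abs_diskAverage_le hG _ z)))
    (fun z hz => by
      rw [hR z (by linarith), diskAverage_eq_zero hR hr hz, sub_zero])).div_const
        (∫ u, diskKernel (δ / 2) u)
  rw [← (integrable_diskSmoothing_and_integral_eq hμ hf.measurable hG hR hr).2] at hlim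
  simp_rw [← fun n =>
    (integrable_diskSmoothing_and_integral_eq (hμs n) hf.measurable hG hR hr).2] at hlim
  obtain ⟨N, hN⟩ := Metric.tendsto_atTop'.1 hlim (ε / 3) (by positivity)
  refine ⟨N, fun n hn => ?_⟩
  have h1 := abs_le.1 (hclose (μs n) (hμs n))
  have h2 := abs_le.1 (hclose μ hμ)
  have h3 := hN n hn
  rw [Real.dist_eq, abs_lt] at h3 ⊢
  constructor <;> linarith [h1.1, h1.2, h2.1, h2.2, h3.1, h3.2]

/-- Vague convergence of probability measures to a probability measure is weak convergence. -/
theorem tendsto_integral_of_forall_hasCompactSupport {μs : ℕ → Measure ℂ}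
    [∀ n, IsProbabilityMeasure (μs n)]
    (h : ∀ f : ℂ → ℝ, Continuous f → HasCompactSupport f →
      Tendsto (fun n => ∫ w, f w ∂(μs n)) atTop (𝓝 (∫ w, f w ∂μ)))
    (hf : Continuous f) (hG : ∀ z, |f z| ≤ G) :
    Tendsto (fun n => ∫ w, f w ∂(μs n)) atTop (𝓝 (∫ w, f w ∂μ)) := by
  have hG0 : 0 ≤ G := (abs_nonneg _).trans (hG 0)
  rw [Metric.tendsto_atTop']
  intro ε hε
  -- The two cut-off errors, for `μs n` and for `μ`, are each at most `G * η ≤ ε / 4`. The `+ 1`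
  -- avoids dividing by zero when `G = 0`.
  set η : ℝ := ε / (4 * (G + 1)) with hη
  have hη0 : 0 < η := by positivity
  obtain ⟨R, hR⟩ : ∃ R : ℕ, 1 - η < μ.real (Metric.closedBall (0 : ℂ) R) := by
    have hm : Monotone fun n : ℕ => Metric.closedBall (0 : ℂ) n := fun a b hab =>
      Metric.closedBall_subset_closedBall (by exact_mod_cast hab)
    have ht := tendsto_measure_iUnion_atTop (μ := μ) hm
    rw [Metric.iUnion_closedBall_nat, measure_univ] at ht
    have ht' := (ENNReal.tendsto_toReal ENNReal.one_ne_top).comp ht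
    exact (ht'.eventually (eventually_gt_nhds (show 1 - η < (1 : ℝ≥0∞).toReal by
      simpa using hη0))).exists
  obtain ⟨χ, hχ1, -, hχc, hχ⟩ := exists_continuous_one_zero_of_isCompact
    (isCompact_closedBall (0 : ℂ) R) isClosed_empty (Set.disjoint_empty _)
  have hχi : ∀ (ν : Measure ℂ) [IsProbabilityMeasure ν], Integrable χ ν := fun ν _ =>
    χ.continuous.integrable_of_hasCompactSupport hχc
  have hcut : ∀ (ν : Measure ℂ) [IsProbabilityMeasure ν],
      |∫ w, f w ∂ν - ∫ w, f w * χ w ∂ν| ≤ G * (1 - ∫ w, χ w ∂ν) := by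
    intro ν _
    have hfi : Integrable f ν := Integrable.of_bound hf.aestronglyMeasurable G
      (Eventually.of_forall hG)
    have hfχ : Integrable (fun w => f w * χ w) ν :=
      (hχi ν).bdd_mul hf.aestronglyMeasurable (Eventually.of_forall hG)
    have e : G * (1 - ∫ w, χ w ∂ν) = ∫ w, G * (1 - χ w) ∂ν := by
      rw [integral_const_mul, integral_sub (integrable_const _) (hχi ν)]
      simp
    rw [← integral_sub hfi hfχ, e, ← Real.norm_eq_abs]
    refine norm_integral_le_of_norm_le (((integrable_const 1).sub (hχi ν)).const_mul G)
      (Eventually.of_forall fun w => ?_)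
    rw [Real.norm_eq_abs, show f w - f w * χ w = f w * (1 - χ w) by ring, abs_mul,
      abs_of_nonneg (sub_nonneg.2 (hχ w).2)]
    exact mul_le_mul_of_nonneg_right (hG w) (sub_nonneg.2 (hχ w).2)
  have hμχ : 1 - η < ∫ w, χ w ∂μ := by
    refine hR.trans_le ?_
    rw [← integral_indicator_one Metric.isClosed_closedBall.measurableSet]
    refine integral_mono ((integrable_const (1 : ℝ)).indicator
      Metric.isClosed_closedBall.measurableSet) (hχi μ) fun w => ?_
    by_cases hw : w ∈ Metric.closedBall (0 : ℂ) R
    · rw [Set.indicator_of_mem hw, hχ1 hw]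
    · rw [Set.indicator_of_notMem hw]
      exact (hχ w).1
  have h1 := h χ χ.continuous hχc
  have h2 := h (fun w => f w * χ w) (hf.mul χ.continuous) hχc.mul_left
  obtain ⟨N, hN⟩ := Metric.tendsto_atTop'.1 h2 (ε / 2) (by positivity)
  -- No mass escapes: the integral of the cut-off `χ` under `μs n` converges to its integral under
  -- `μ`, which exceeds `1 - η`.
  obtain ⟨N', hN'⟩ := eventually_atTop.1 (h1.eventually (eventually_gt_nhds hμχ))
  refine ⟨max N N', fun n hn => ?_⟩
  have h3 := hN n ((le_max_left _ _).trans_lt hn)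
  have h4 := hN' n ((le_max_right _ _).trans hn.le)
  have h5 := abs_le.1 (hcut (μs n))
  have h6 := abs_le.1 (hcut μ)
  have h7 : G * η ≤ ε / 4 := by
    rw [hη, mul_div_assoc', div_le_div_iff₀ (by positivity) (by positivity)]
    nlinarith
  have h8 : G * (1 - ∫ w, χ w ∂(μs n)) ≤ G * η := mul_le_mul_of_nonneg_left (by linarith) hG0
  have h9 : G * (1 - ∫ w, χ w ∂μ) ≤ G * η := mul_le_mul_of_nonneg_left (by linarith) hG0
  rw [Real.dist_eq, abs_lt] at h3 ⊢
  constructor <;> linarith [h5.1, h5.2, h6.1, h6.2, h3.1, h3.2]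

theorem tendsto_probabilityMeasure_of_tendsto_logPotential {μs : ℕ → ProbabilityMeasure ℂ}
    {μ : ProbabilityMeasure ℂ}
    (hμs : ∀ n, Integrable (fun w => Real.log (1 + ‖w‖)) (μs n : Measure ℂ))
    (hμ : Integrable (fun w => Real.log (1 + ‖w‖)) (μ : Measure ℂ))
    (hL : ∀ᵐ z : ℂ, Tendsto (fun n => logPotential (μs n) z) atTop (𝓝 (logPotential μ z))) :
    Tendsto μs atTop (𝓝 μ) := by
  rw [ProbabilityMeasure.tendsto_iff_forall_integral_tendsto]
  intro f
  exact tendsto_integral_of_forall_hasCompactSupport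
    (fun g hg hgc => tendsto_integral_of_hasCompactSupport hμs hμ hL hg hgc)
    f.continuous (fun z => f.norm_coe_le_norm z)

end WeakConvergence

/-! ### Spectral measures and the conclusion. -/

section CircularLaw

theorem integral_sum_map_dirac (s : Multiset ℂ) (g : ℂ → ℂ) (f : ℂ → ℝ) :
    Integrable f (s.map fun z => Measure.dirac (g z)).sum ∧
      ∫ w, f w ∂(s.map fun z => Measure.dirac (g z)).sum = (s.map fun z => f (g z)).sum := by
  induction s using Multiset.induction_on with
  | empty => simp
  | cons a s ih =>
    rw [Multiset.map_cons, Multiset.sum_cons, Multiset.map_cons, Multiset.sum_cons, ← ih.2]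
    have h : Integrable f (Measure.dirac (g a)) := integrable_dirac (by simp)
    exact ⟨h.add_measure ih.1, by rw [integral_add_measure h ih.1, integral_dirac]⟩

theorem integrable_empiricalSpectralMeasure {k : ℕ} (A : Matrix (Fin (k + 1)) (Fin (k + 1)) ℂ)
    (f : ℂ → ℝ) : Integrable f (empiricalSpectralMeasure A) :=
  (integral_sum_map_dirac _ _ f).1.smul_measure (by simp)

theorem charpoly_eval_eq_prod {k : ℕ} (A : Matrix (Fin k) (Fin k) ℂ) (x : ℂ) :
    A.charpoly.eval x = ((spectrumMultiset A).map fun a => x - a).prod := by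
  conv_lhs => rw [(IsAlgClosed.splits A.charpoly).eq_prod_roots_of_monic A.charpoly_monic]
  rw [Polynomial.eval_multiset_prod, Multiset.map_map]
  simp [spectrumMultiset]

theorem norm_eval_charpoly {k : ℕ} (A : Matrix (Fin k) (Fin k) ℂ) (x : ℂ) :
    ‖A.charpoly.eval x‖ = ‖(A - x • 1).det‖ := by
  rw [Matrix.eval_charpoly, Matrix.scalar_apply, ← Matrix.smul_one_eq_diagonal, ← neg_sub,
    Matrix.det_neg, norm_mul, norm_pow, norm_neg, norm_one, one_pow, one_mul]

theorem log_norm_multiset_prod (s : Multiset ℂ) (hs : s.prod ≠ 0) :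
    Real.log ‖s.prod‖ = (s.map fun a => Real.log ‖a‖).sum := by
  induction s using Multiset.induction_on with
  | empty => simp
  | cons a s ih =>
    rw [Multiset.prod_cons] at hs ⊢
    rw [Multiset.map_cons, Multiset.sum_cons, norm_mul,
      Real.log_mul (norm_ne_zero_iff.2 (left_ne_zero_of_mul hs))
        (norm_ne_zero_iff.2 (right_ne_zero_of_mul hs)), ih (right_ne_zero_of_mul hs)]

/-- The determinant is, up to sign, the product of the differences between `√(k + 1) z` and the
eigenvalues. At an eigenvalue `Real.log 0 = 0` would break the sum formula, hence the hypothesis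
`hz`; the scaling by `√(k + 1)` yields the term `log (k + 1) / 2`. -/
theorem logPotential_empiricalSpectralMeasure {k : ℕ}
    (A : Matrix (Fin (k + 1)) (Fin (k + 1)) ℂ) {z : ℂ}
    (hz : (A - ((√(k + 1 : ℝ) : ℂ) * z) • 1).det ≠ 0) :
    logPotential (empiricalSpectralMeasure A) z =
      Real.log ‖(A - ((√(k + 1 : ℝ) : ℂ) * z) • 1).det‖ / (k + 1) - Real.log (k + 1) / 2 := by
  have hk : (0 : ℝ) < k + 1 := by positivity
  have hs : (0 : ℝ) < √(k + 1 : ℝ) := Real.sqrt_pos.2 hk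
  have hsc : (√(k + 1 : ℝ) : ℂ) ≠ 0 := by exact_mod_cast hs.ne'
  set x : ℂ := (√(k + 1 : ℝ) : ℂ) * z with hx
  have hne : ((spectrumMultiset A).map fun a => x - a).prod ≠ 0 := by
    rw [← charpoly_eval_eq_prod, ← norm_ne_zero_iff, norm_eval_charpoly]
    exact norm_ne_zero_iff.2 hz
  have hdet : Real.log ‖(A - x • 1).det‖ =
      ((spectrumMultiset A).map fun a => Real.log ‖x - a‖).sum := by
    rw [← norm_eval_charpoly, charpoly_eval_eq_prod, log_norm_multiset_prod _ hne,
      Multiset.map_map]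
    rfl
  have hterm : ∀ a ∈ spectrumMultiset A,
      Real.log ‖z - a / (√((k + 1 : ℕ) : ℝ) : ℂ)‖ =
        Real.log ‖x - a‖ + -(Real.log (k + 1) / 2) := by
    intro a ha
    have hxa : x - a ≠ 0 := fun h =>
      hne (Multiset.prod_eq_zero (Multiset.mem_map.2 ⟨a, ha, h⟩))
    have e : z - a / (√((k + 1 : ℕ) : ℝ) : ℂ) = (x - a) / (√(k + 1 : ℝ) : ℂ) := by
      push_cast
      rw [hx]
      field_simp
    rw [e, norm_div, Real.log_div (norm_ne_zero_iff.2 hxa) (norm_ne_zero_iff.2 hsc),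
      Complex.norm_real, Real.norm_eq_abs, abs_of_pos hs, Real.log_sqrt hk.le]
    ring
  rw [logPotential, empiricalSpectralMeasure, integral_smul_measure,
    (integral_sum_map_dirac _ _ _).2, Multiset.map_congr rfl hterm, Multiset.sum_map_add,
    ← hdet, Multiset.map_const', Multiset.sum_replicate, card_spectrumMultiset]
  simp only [ENNReal.toReal_inv, ENNReal.toReal_natCast, smul_eq_mul, nsmul_eq_mul]
  push_cast
  field_simp
  ring

theorem logPotential_uniformDisk : logPotential uniformDisk = diskPotential :=
  funext integral_log_norm_sub_uniformDisk

theorem ae_tendsto_empiricalSpectralLaw {Ω : Type*} [MeasurableSpace Ω] {P : Measure Ω}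
    [IsProbabilityMeasure P] {M : (k : ℕ) → Ω → Matrix (Fin (k + 1)) (Fin (k + 1)) ℂ}
    (hM : ∀ k, IsGinibre P (M k)) :
    ∀ᵐ ω ∂P, Tendsto (fun k => empiricalSpectralLaw (M k ω)) atTop (𝓝 uniformDiskLaw) := by
  filter_upwards [ae_ae_tendsto_log_norm_det hM] with ω hω
  refine tendsto_probabilityMeasure_of_tendsto_logPotential
    (fun k => integrable_empiricalSpectralMeasure (M k ω) _)
    (integrable_log_one_add_norm_of_ae_le (μ := uniformDisk) ae_uniformDisk_norm_le_one) ?_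
  filter_upwards [hω, ae_all_iff.2 fun k => ae_det_sub_smul_ne_zero (M k ω)] with z hz hne
  change Tendsto (fun k => logPotential (empiricalSpectralMeasure (M k ω)) z) atTop
    (𝓝 (logPotential uniformDisk z))
  rw [logPotential_uniformDisk]
  exact hz.congr fun k => (logPotential_empiricalSpectralMeasure (M k ω) (hne k)).symm

theorem tendsto_natPred_atTop : Tendsto PNat.natPred atTop atTop :=
  OrderIso.pnatIsoNat.tendsto_atTop

end CircularLaw

theorem mainTheorem7 {Ω : Type*} [MeasurableSpace Ω] (P : Measure Ω) [IsProbabilityMeasure P]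
    (M : (N : ℕ+) → Ω → Matrix (Fin (N : ℕ)) (Fin (N : ℕ)) ℂ)
    (hM : ∀ N : ℕ+, IsGinibre P (M N)) :
    ∀ᵐ ω ∂P,
      Tendsto (fun N : ℕ+ => empiricalSpectralLaw (M N ω)) atTop (𝓝 uniformDiskLaw) := by
  -- Sizes are indexed by `N = k + 1` with `k : ℕ` up to here, and the limit is carried back along
  -- `PNat.natPred`.
  have h := ae_tendsto_empiricalSpectralLaw (P := P) (M := fun k => M (Nat.succPNat k))
    fun k => hM (Nat.succPNat k)
  filter_upwards [h] with ω hω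
  have h1 : Tendsto (fun k : ℕ => empiricalSpectralLaw (M (Nat.succPNat k) ω)) atTop
      (𝓝 uniformDiskLaw) := hω
  refine (h1.comp tendsto_natPred_atTop).congr fun N => ?_
  simp only [Function.comp_apply]
  rw [PNat.succPNat_natPred]
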